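/- Let $\Gamma$ be a countably infinite discrete amenable group and let $f=\sum_{\gamma}f_\gamma\cdot\gamma\in\mathbb{Z}\Gamma$. Write $\mathbb{T}=\mathbb{R}/\mathbb{Z}$ and, for a function $x$ on $\Gamma$ with values in $\mathbb{T}$ or $\mathbb{R}$, put $(\lambda^\gamma x)_\delta=x_{\gamma^{-1}\delta}$ (the left shift) and $(\rho^f x)_\gamma=\sum_{\delta\in\Gamma}f_\delta x_{\gamma\delta}$. Let $X_f=\{x\in\mathbb{T}^\Gamma : \rho^f x=0\}$, a compact left-shift-invariant subgroup of $\mathbb{T}^\Gamma$, and let $\lambda_f$ be the left shift action of $\Gamma$ on $X_f$ (the principal algebraic action defined by $f$). Let $Y_f$ be the set of all $y\in\ell^\infty(\Gamma,\mathbb{R})$ with $0\le y_\gamma<1$ for every $\gamma\in\Gamma$ and $(y_\gamma \bmod 1)_{\gamma\in\Gamma}\in X_f$, let $Z_f=\rho^f(Y_f)\subset\ell^\infty(\Gamma,\mathbb{Z})$, and let $\bar Y_f$, $\bar Z_f$ be the weak$^*$ closures of $Y_f$, $Z_f$ in $\ell^\infty(\Gamma,\mathbb{R})=\ell^1(\Gamma,\mathbb{R})^*$.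 These are weak$^*$-compact and left-shift-invariant; let $\bar\lambda_{\bar Y_f}$ and $\bar\lambda_{\bar Z_f}$ be the left shift actions of $\Gamma$ on them. For a continuous action of $\Gamma$ on a nonempty compact space $X$ the topological entropy is $$\mathrm{h}_{\mathrm{top}}=\sup_{\mathcal U}\,\lim_{F}\,\frac1{|F|}\log N\Bigl(\bigvee_{\gamma\in F}\gamma^{-1}\mathcal U\Bigr)\in[0,\infty],$$ where $\mathcal U$ runs over the open covers of $X$, $N(\cdot)$ is the minimal cardinality of a subcover, and the limit is taken as the nonempty finite set $F\subset\Gamma$ becomes more and more left invariant, i.e. as $|\gamma F\,\triangle\,F|/|F|\to0$ for every $\gamma\in\Gamma$. If $\mathrm{h}_{\mathrm{top}}(\lambda_f)<\infty$, then $$\mathrm{h}_{\mathrm{top}}(\bar\lambda_{\bar Z_f})=\mathrm{h}_{\mathrm{top}}(\bar\lambda_{\bar Y_f})=\mathrm{h}_{\mathrm{top}}(\lambda_f).$$ -/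

import Mathlib

open Filter Topology
open scoped ENNReal Pointwise symmDiff

noncomputable section

/-! ### Amenability and topological entropy -/

open scoped Classical in
/-- The nonempty finite sets `F ⊆ Γ` that are left `(K, ε)`-invariant:
`|γF ∆ F| ≤ ε |F|` for every `γ ∈ K`. -/
def leftInvariantSets {Γ : Type*} [Group Γ] (K : Finset Γ) (ε : ℝ) : Set (Finset Γ) :=
  {F | F.Nonempty ∧ ∀ γ ∈ K, (((γ • F) ∆ F).card : ℝ) ≤ ε * F.card}

/-- Amenability of a discrete group (the left Følner condition). -/
def IsAmenableGroup (Γ : Type*) [Group Γ] : Prop :=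
  ∀ (K : Finset Γ) (ε : ℝ), 0 < ε → (leftInvariantSets K ε).Nonempty

/-- The filter on the finite subsets of `Γ` along which a set becomes more and more left invariant.
A sequence of nonempty finite sets is a left Følner sequence if and only if it tends to
this filter. -/
def leftFolnerFilter (Γ : Type*) [Group Γ] : Filter (Finset Γ) :=
  ⨅ (K : Finset Γ) (ε : ℝ) (_ : 0 < ε), 𝓟 (leftInvariantSets K ε)

/-- `U` is an open cover of the space `X`. -/
def IsOpenCoverOf {X : Type*} [TopologicalSpace X] (U : Set (Set X)) : Prop :=
  (∀ u ∈ U, IsOpen u) ∧ ⋃₀ U = Set.univ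

/-- The minimal cardinality `N(U)` of a subcover of `U` (`⊤` if there is no finite subcover). -/
def minCoverCard {X : Type*} (U : Set (Set X)) : ℕ∞ :=
  ⨅ (V : Finset (Set X)) (_ : (V : Set (Set X)) ⊆ U ∧ ⋃₀ (V : Set (Set X)) = Set.univ),
    (V.card : ℕ∞)

/-- The common refinement `⋁_{γ ∈ F} γ⁻¹ U` of the translates of a cover `U`. -/
def coverJoin {Γ X : Type*} [Group Γ] [MulAction Γ X] (U : Set (Set X)) (F : Finset Γ) :
    Set (Set X) :=
  {s | ∃ φ : Γ → Set X, (∀ γ ∈ F, φ γ ∈ U) ∧ s = ⋂ γ ∈ F, (fun x : X => γ • x) ⁻¹' φ γ}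

/-- The topological entropy of an action of `Γ` on `X`:
`h_top = sup_U lim_F (1/|F|) log N(⋁_{γ ∈ F} γ⁻¹ U)`, where `U` runs over the open covers of `X`
and the limit is taken as `F` becomes more and more left invariant. For amenable `Γ` and compact
`X ≠ ∅` this limit exists, and it is the limit along every left Følner sequence; it is written
here as an upper limit, which needs no existence. -/
def topEntropy (Γ X : Type*) [Group Γ] [MulAction Γ X] [TopologicalSpace X] : EReal :=
  ⨆ (U : Set (Set X)) (_ : IsOpenCoverOf U),
    limsup (fun F : Finset Γ =>
      ENNReal.log ((minCoverCard (coverJoin U F) : ℕ∞) : ℝ≥0∞) / ((F.card : ℝ) : EReal))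
      (leftFolnerFilter Γ)

/-! ### The principal algebraic action -/

/-- The left shift `(λ^γ x)_δ = x_{γ⁻¹δ}` on `A^Γ`. -/
def leftShift {Γ A : Type*} [Group Γ] (γ : Γ) (x : Γ → A) : Γ → A := fun δ => x (γ⁻¹ * δ)

/-- `ρ^f = ∑_δ f_δ ρ^δ`, where `(ρ^δ x)_γ = x_{γδ}`, for `f ∈ ℤΓ`, on `A^Γ` with `A` an
abelian group. -/
def rightConv {Γ A : Type*} [Group Γ] [AddCommGroup A] (f : MonoidAlgebra ℤ Γ) (x : Γ → A) :
    Γ → A :=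
  fun γ => ∑ δ ∈ f.coeff.support, f.coeff δ • x (γ * δ)

/-- `X_f = ker ρ^f ⊆ 𝕋^Γ`, with `𝕋 = ℝ/ℤ`. -/
def Xf {Γ : Type*} [Group Γ] (f : MonoidAlgebra ℤ Γ) : Set (Γ → UnitAddCircle) :=
  {x | rightConv f x = 0}

theorem rightConv_leftShift {Γ A : Type*} [Group Γ] [AddCommGroup A] (f : MonoidAlgebra ℤ Γ)
    (γ : Γ) (x : Γ → A) : rightConv f (leftShift γ x) = leftShift γ (rightConv f x) := by
  funext δ
  simp [rightConv, leftShift, mul_assoc]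

theorem leftShift_one {Γ A : Type*} [Group Γ] (x : Γ → A) : leftShift 1 x = x := by
  funext δ
  simp [leftShift]

theorem leftShift_mul {Γ A : Type*} [Group Γ] (γ γ' : Γ) (x : Γ → A) :
    leftShift (γ * γ') x = leftShift γ (leftShift γ' x) := by
  funext δ
  simp [leftShift, mul_assoc]

theorem leftShift_mem_Xf {Γ : Type*} [Group Γ] {f : MonoidAlgebra ℤ Γ} (γ : Γ)
    {x : Γ → UnitAddCircle} (hx : x ∈ Xf f) : leftShift γ x ∈ Xf f := by
  have h : rightConv f x = 0 := hx
  change rightConv f (leftShift γ x) = 0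
  rw [rightConv_leftShift, h]
  rfl

/-- The principal algebraic action `λ_f`: the left shift on `X_f`. -/
instance Xf.instMulAction {Γ : Type*} [Group Γ] (f : MonoidAlgebra ℤ Γ) :
    MulAction Γ (Xf f) where
  smul γ x := ⟨leftShift γ x.1, leftShift_mem_Xf γ x.2⟩
  one_smul x := Subtype.ext (leftShift_one x.1)
  mul_smul γ γ' x := Subtype.ext (leftShift_mul γ γ' x.1)

/-! ### The space `ℓ^∞(Γ, ℝ)` with its weak* topology -/

/-- `ℓ^∞(Γ, ℝ)`, a type of its own because it carries the weak* topology. -/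
def EllInf (Γ : Type*) : Type _ := {v : Γ → ℝ // Memℓp v ∞}

/-- The weak* topology on `ℓ^∞(Γ, ℝ) = ℓ¹(Γ, ℝ)*`: the coarsest topology for which
`v ↦ ∑_γ h_γ v_γ` is continuous for every `h ∈ ℓ¹(Γ, ℝ)`. -/
instance EllInf.instTopologicalSpace (Γ : Type*) : TopologicalSpace (EllInf Γ) :=
  TopologicalSpace.induced
    (fun v (h : {h : Γ → ℝ // Memℓp h 1}) => ∑' γ, h.1 γ * v.1 γ) inferInstance

theorem memℓp_leftShift {Γ : Type*} [Group Γ] (γ : Γ) {v : Γ → ℝ} (hv : Memℓp v ∞) :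
    Memℓp (leftShift γ v) ∞ := by
  obtain ⟨C, hC⟩ := memℓp_infty_iff.1 hv
  refine memℓp_infty ⟨C, ?_⟩
  rintro _ ⟨δ, rfl⟩
  exact hC ⟨γ⁻¹ * δ, rfl⟩

theorem memℓp_rightConv {Γ : Type*} [Group Γ] (f : MonoidAlgebra ℤ Γ) {v : Γ → ℝ}
    (hv : Memℓp v ∞) : Memℓp (rightConv f v) ∞ := by
  obtain ⟨C, hC⟩ := memℓp_infty_iff.1 hv
  refine memℓp_infty ⟨∑ δ ∈ f.coeff.support, |(f.coeff δ : ℝ)| * C, ?_⟩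
  rintro _ ⟨γ, rfl⟩
  refine (norm_sum_le _ _).trans (Finset.sum_le_sum fun δ _ => ?_)
  rw [zsmul_eq_mul, norm_mul, Real.norm_eq_abs]
  exact mul_le_mul_of_nonneg_left (hC ⟨γ * δ, rfl⟩) (abs_nonneg _)

/-- The left shift action on `ℓ^∞(Γ, ℝ)`. -/
instance EllInf.instMulAction (Γ : Type*) [Group Γ] : MulAction Γ (EllInf Γ) where
  smul γ v := ⟨leftShift γ v.1, memℓp_leftShift γ v.2⟩
  one_smul v := Subtype.ext (leftShift_one v.1)
  mul_smul γ γ' v := Subtype.ext (leftShift_mul γ γ' v.1)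

/-- `ρ̄^f` on `ℓ^∞(Γ, ℝ)`. -/
def rhoBar {Γ : Type*} [Group Γ] (f : MonoidAlgebra ℤ Γ) (v : EllInf Γ) : EllInf Γ :=
  ⟨rightConv f v.1, memℓp_rightConv f v.2⟩

/-- Coordinatewise reduction modulo `1`, from `ℓ^∞(Γ, ℝ)` to `𝕋^Γ`. -/
def etaMap {Γ : Type*} (w : EllInf Γ) : Γ → UnitAddCircle := fun γ => (w.1 γ : UnitAddCircle)

/-- The linearization `W_f = η⁻¹(X_f)`. -/
def Wf {Γ : Type*} [Group Γ] (f : MonoidAlgebra ℤ Γ) : Set (EllInf Γ) := etaMap ⁻¹' Xf f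

/-- `Y_f = W_f ∩ [0,1)^Γ`. -/
def Yf {Γ : Type*} [Group Γ] (f : MonoidAlgebra ℤ Γ) : Set (EllInf Γ) :=
  Wf f ∩ {w | ∀ γ, w.1 γ ∈ Set.Ico (0 : ℝ) 1}

/-- `Z_f = ρ̄^f(Y_f)`. -/
def Zf {Γ : Type*} [Group Γ] (f : MonoidAlgebra ℤ Γ) : Set (EllInf Γ) := rhoBar f '' Yf f

/-- The weak* closure of `Y_f`. -/
def YfBar {Γ : Type*} [Group Γ] (f : MonoidAlgebra ℤ Γ) : Set (EllInf Γ) := closure (Yf f)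

/-- The weak* closure of `Z_f`. -/
def ZfBar {Γ : Type*} [Group Γ] (f : MonoidAlgebra ℤ Γ) : Set (EllInf Γ) := closure (Zf f)

theorem EllInf.continuous_smul {Γ : Type*} [Group Γ] (γ : Γ) :
    Continuous (fun v : EllInf Γ => γ • v) := by
  refine continuous_induced_rng.2 (continuous_pi fun h => ?_)
  have hh : Memℓp (fun δ => h.1 (γ * δ)) 1 := by
    have h1 : (0 : ℝ) < (1 : ℝ≥0∞).toReal := by simp
    rw [memℓp_gen_iff h1]
    exact ((memℓp_gen_iff h1).1 h.2).comp_injective (mul_right_injective γ)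
  have key : ∀ v : EllInf Γ,
      ∑' δ, h.1 δ * (γ • v).1 δ = ∑' δ, h.1 (γ * δ) * v.1 δ := by
    intro v
    rw [← (Equiv.mulLeft γ).tsum_eq (fun δ => h.1 δ * (γ • v).1 δ)]
    refine tsum_congr fun δ => ?_
    change h.1 (γ * δ) * v.1 (γ⁻¹ * (γ * δ)) = _
    rw [inv_mul_cancel_left]
  have hd : Continuous (fun (v : EllInf Γ) (h : {h : Γ → ℝ // Memℓp h 1}) =>
      ∑' δ, h.1 δ * v.1 δ) := continuous_induced_dom
  have hc : Continuous (fun v : EllInf Γ => ∑' δ, h.1 (γ * δ) * v.1 δ) :=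
    (continuous_apply (⟨_, hh⟩ : {h : Γ → ℝ // Memℓp h 1})).comp hd
  exact hc.congr fun v => (key v).symm

theorem smul_mem_Yf {Γ : Type*} [Group Γ] {f : MonoidAlgebra ℤ Γ} (γ : Γ) {v : EllInf Γ}
    (hv : v ∈ Yf f) : γ • v ∈ Yf f :=
  ⟨leftShift_mem_Xf γ (x := etaMap v) hv.1, fun δ => hv.2 (γ⁻¹ * δ)⟩

theorem smul_mem_Zf {Γ : Type*} [Group Γ] {f : MonoidAlgebra ℤ Γ} (γ : Γ) {v : EllInf Γ}
    (hv : v ∈ Zf f) : γ • v ∈ Zf f := by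
  obtain ⟨y, hy, rfl⟩ := hv
  exact ⟨γ • y, smul_mem_Yf γ hy, Subtype.ext (rightConv_leftShift f γ y.1)⟩

theorem smul_mem_YfBar {Γ : Type*} [Group Γ] {f : MonoidAlgebra ℤ Γ} (γ : Γ) {v : EllInf Γ}
    (hv : v ∈ YfBar f) : γ • v ∈ YfBar f :=
  map_mem_closure (EllInf.continuous_smul γ) hv fun _ h => smul_mem_Yf γ h

theorem smul_mem_ZfBar {Γ : Type*} [Group Γ] {f : MonoidAlgebra ℤ Γ} (γ : Γ) {v : EllInf Γ}
    (hv : v ∈ ZfBar f) : γ • v ∈ ZfBar f :=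
  map_mem_closure (EllInf.continuous_smul γ) hv fun _ h => smul_mem_Zf γ h

/-- The left shift action on the weak* closure of `Y_f`. -/
instance YfBar.instMulAction {Γ : Type*} [Group Γ] (f : MonoidAlgebra ℤ Γ) :
    MulAction Γ (YfBar f) where
  smul γ v := ⟨γ • v.1, smul_mem_YfBar γ v.2⟩
  one_smul v := Subtype.ext (one_smul Γ v.1)
  mul_smul γ γ' v := Subtype.ext (mul_smul γ γ' v.1)

/-- The left shift action on the weak* closure of `Z_f`. -/
instance ZfBar.instMulAction {Γ : Type*} [Group Γ] (f : MonoidAlgebra ℤ Γ) :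
    MulAction Γ (ZfBar f) where
  smul γ v := ⟨γ • v.1, smul_mem_ZfBar γ v.2⟩
  one_smul v := Subtype.ext (one_smul Γ v.1)
  mul_smul γ γ' v := Subtype.ext (mul_smul γ γ' v.1)

end

/-
Reduction modulo `1` makes `X_f` a factor of `Ȳ_f`, so `h(X_f) ≤ h(Ȳ_f)`. The other two inequalities
rest on one consequence of `h(X_f) < ∞`: on a large invariant window `F` the real kernel of `ρ^f`
has dimension `o(|F|)`. Indeed, its small elements embed isometrically into `X_f`, and comparing the
volumes of balls of radii `1/4` and `ε → 0` would otherwise make the entropy of `X_f` infinite.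

The points of `Ȳ_f` with prescribed image in `Z̄_f` over the window lie in a bounded part of a
translate of this kernel, which has an `ε`-net of size `exp (o(|F|))`; hence `h(Ȳ_f) ≤ h(Z̄_f)`.

If `y₀, y ∈ Y_f` are close modulo `1` on the window, then `ρ^f` annihilates the difference `w` of
`y` and `y₀` reduced modulo `1`, so `ρ^f y` is determined by `y₀` and the integers carried in
`y₀ + w`. The carries are given by the threshold sets `{-y₀ ≤ w}` and `{1 - y₀ ≤ w}` of elements `w`
of the kernel. A family of threshold sets of a `d`-dimensional space shatters no set of more than
`d` points, so by the Sauer–Shelah lemma there are only `exp (o(|F|))` of them; hence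
`h(Z̄_f) ≤ h(X_f)`.
-/

noncomputable section

/-! ### Covers and entropy -/

section Covers

variable {X Y κ : Type*} {C : Set (Set X)} {Q : ℝ} {S : Set X}

/-- `S` is covered by at most `Q` members of the family `C`. The bound `Q` is real because it
will be of the form `exp (δ |F|)`. -/
def IsCoveredBy (C : Set (Set X)) (Q : ℝ) (S : Set X) : Prop :=
  ∃ P : Finset (Set X), (P : Set (Set X)) ⊆ C ∧ (P.card : ℝ) ≤ Q ∧ S ⊆ ⋃₀ (P : Set (Set X))

theorem isCoveredBy_empty (hQ : 0 ≤ Q) : IsCoveredBy C Q ∅ :=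
  ⟨∅, by simp, by simpa using hQ, Set.empty_subset _⟩

theorem IsCoveredBy.mono {Q' : ℝ} (h : IsCoveredBy C Q S) (hQ : Q ≤ Q') : IsCoveredBy C Q' S :=
  let ⟨P, hPC, hPQ, hSP⟩ := h
  ⟨P, hPC, hPQ.trans hQ, hSP⟩

theorem isCoveredBy_of_subset_biUnion {J : Finset κ} {T : κ → Set X} (hJ : (J.card : ℝ) ≤ Q)
    (hS : S ⊆ ⋃ j ∈ J, T j) (hT : ∀ j ∈ J, ∀ x ∈ T j, ∃ s ∈ C, T j ⊆ s) :
    IsCoveredBy C Q S := by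
  classical
  choose! s hsC hTs using fun (j : κ) (h : j ∈ J ∧ (T j).Nonempty) => hT j h.1 _ h.2.some_mem
  refine ⟨(J.filter fun j => (T j).Nonempty).image s, ?_, ?_, fun x hx => ?_⟩
  · rintro _ ht
    obtain ⟨j, hj, rfl⟩ := Finset.mem_image.1 (Finset.mem_coe.1 ht)
    exact hsC j (Finset.mem_filter.1 hj)
  · refine le_trans ?_ hJ
    exact_mod_cast Finset.card_image_le.trans (Finset.card_filter_le _ _)
  · obtain ⟨j, hj, hxj⟩ := Set.mem_iUnion₂.1 (hS hx)
    have hne : (T j).Nonempty := ⟨x, hxj⟩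
    exact ⟨s j, Finset.mem_coe.2 (Finset.mem_image_of_mem s (Finset.mem_filter.2 ⟨hj, hne⟩)),
      hTs j ⟨hj, hne⟩ hxj⟩

theorem isCoveredBy_biUnion (V : Finset κ) {T : κ → Set X} (hT : ∀ i ∈ V, IsCoveredBy C Q (T i)) :
    IsCoveredBy C (V.card * Q) (⋃ i ∈ V, T i) := by
  classical
  choose! P hPC hPQ hTP using hT
  refine ⟨V.biUnion P, ?_, ?_, Set.iUnion₂_subset fun i hi x hx => ?_⟩
  · intro s hs
    obtain ⟨i, hi, hsi⟩ := Finset.mem_biUnion.1 (Finset.mem_coe.1 hs)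
    exact hPC i hi hsi
  · calc ((V.biUnion P).card : ℝ) ≤ ∑ i ∈ V, ((P i).card : ℝ) := by
          exact_mod_cast Finset.card_biUnion_le
      _ ≤ V.card * Q := by simpa only [nsmul_eq_mul] using Finset.sum_le_card_nsmul V _ Q hPQ
  · obtain ⟨s, hs, hxs⟩ := hTP i hi hx
    exact ⟨s, Finset.mem_coe.2 (Finset.mem_biUnion.2 ⟨i, hi, hs⟩), hxs⟩

theorem minCoverCard_le_card {V : Finset (Set X)} (hV : (V : Set (Set X)) ⊆ C)
    (hcov : ⋃₀ (V : Set (Set X)) = Set.univ) : minCoverCard C ≤ V.card :=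
  iInf₂_le V ⟨hV, hcov⟩

theorem exists_subcover_card_eq_minCoverCard (h : minCoverCard C ≠ ⊤) :
    ∃ V : Finset (Set X), (V : Set (Set X)) ⊆ C ∧ ⋃₀ (V : Set (Set X)) = Set.univ ∧
      minCoverCard C = V.card := by
  have hlt : minCoverCard C < minCoverCard C + 1 := (ENat.lt_add_one_iff h).2 le_rfl
  obtain ⟨V, hV⟩ := iInf_lt_iff.1 hlt
  obtain ⟨⟨hVC, hcov⟩, hVlt⟩ := iInf_lt_iff.1 hV
  exact ⟨V, hVC, hcov,
    le_antisymm (minCoverCard_le_card hVC hcov) ((ENat.lt_add_one_iff h).1 hVlt)⟩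

theorem minCoverCard_le_mul_of_correspondence {D : Set (Set Y)} (hQ : 0 < Q) {R : X → Y → Prop}
    (hR : ∀ x, ∃ y, R x y) (hD : ∀ v ∈ D, IsCoveredBy C Q {x | ∃ y ∈ v, R x y}) :
    (minCoverCard C : ℝ≥0∞) ≤ (minCoverCard D : ℝ≥0∞) * ENNReal.ofReal Q := by
  by_cases htop : minCoverCard D = ⊤
  · simp [htop, ENNReal.top_mul, hQ]
  obtain ⟨V, hVD, hcov, hcard⟩ := exists_subcover_card_eq_minCoverCard htop
  obtain ⟨P, hPC, hPQ, hP⟩ := isCoveredBy_biUnion V fun v hv => hD v (hVD hv)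
  have hPcov : ⋃₀ (P : Set (Set X)) = Set.univ := by
    refine Set.eq_univ_of_forall fun x => ?_
    obtain ⟨y, hxy⟩ := hR x
    obtain ⟨v, hv, hyv⟩ : y ∈ ⋃₀ (V : Set (Set Y)) := hcov ▸ Set.mem_univ y
    exact hP (Set.mem_iUnion₂.2 ⟨v, hv, y, hyv, hxy⟩)
  calc (minCoverCard C : ℝ≥0∞) ≤ ((P.card : ℕ∞) : ℝ≥0∞) := by
        exact_mod_cast minCoverCard_le_card hPC hPcov
    _ = ENNReal.ofReal P.card := by rw [ENat.toENNReal_coe, ENNReal.ofReal_natCast]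
    _ ≤ ENNReal.ofReal (V.card * Q) := ENNReal.ofReal_le_ofReal hPQ
    _ = (minCoverCard D : ℝ≥0∞) * ENNReal.ofReal Q := by
        rw [ENNReal.ofReal_mul (Nat.cast_nonneg _), ENNReal.ofReal_natCast, hcard,
          ENat.toENNReal_coe]

end Covers

section Entropy

variable {Γ X Y : Type*} [Group Γ]

theorem eventually_mem_leftInvariantSets (K : Finset Γ) {ε : ℝ} (hε : 0 < ε) :
    ∀ᶠ F in leftFolnerFilter Γ, F ∈ leftInvariantSets K ε :=
  mem_iInf_of_mem K (mem_iInf_of_mem ε (mem_iInf_of_mem hε (mem_principal_self _)))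

theorem eventually_nonempty_leftFolnerFilter : ∀ᶠ F in leftFolnerFilter Γ, F.Nonempty :=
  (eventually_mem_leftInvariantSets ∅ one_pos).mono fun _ hF => hF.1

theorem limsup_le_limsup_of_forall_pos_eventually_le_add {α : Type*} {l : Filter α}
    {u v : α → EReal} (h : ∀ δ : ℝ, 0 < δ → ∀ᶠ a in l, u a ≤ v a + δ) :
    limsup u l ≤ limsup v l := by
  refine EReal.le_of_forall_lt_iff_le.1 fun z hz => ?_
  obtain ⟨b, hvb, hbz⟩ := EReal.lt_iff_exists_real_btwn.1 hz
  refine limsup_le_of_le (by isBoundedDefault) ?_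
  filter_upwards [h (z - b) (sub_pos.2 (EReal.coe_lt_coe_iff.1 hbz)),
    eventually_lt_of_limsup_lt hvb] with a ha hva
  calc u a ≤ v a + ((z - b : ℝ) : EReal) := ha
    _ ≤ (b : EReal) + ((z - b : ℝ) : EReal) := by gcongr
    _ = z := by rw [← EReal.coe_add, add_sub_cancel]

variable [MulAction Γ X] [MulAction Γ Y]

theorem exists_eq_preimage_of_mem_coverJoin {π : Y → X} (hπ : ∀ (γ : Γ) y, π (γ • y) = γ • π y)
    {U : Set (Set X)} {F : Finset Γ} {s : Set Y}
    (hs : s ∈ coverJoin (Set.preimage π '' U) F) : ∃ t ∈ coverJoin U F, s = π ⁻¹' t := by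
  obtain ⟨φ, hφ, rfl⟩ := hs
  choose! ψ hψ hψφ using hφ
  refine ⟨_, ⟨ψ, hψ, rfl⟩, ?_⟩
  simp only [Set.preimage_iInter]
  refine Set.iInter₂_congr fun γ hγ => ?_
  rw [← hψφ γ hγ]
  ext y
  simp only [Set.mem_preimage, hπ]

variable [TopologicalSpace X] [TopologicalSpace Y]

theorem limsup_log_minCoverCard_le_topEntropy {U : Set (Set X)} (hU : IsOpenCoverOf U) :
    limsup (fun F : Finset Γ =>
      ENNReal.log (minCoverCard (coverJoin U F) : ℝ≥0∞) / ((F.card : ℝ) : EReal))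
      (leftFolnerFilter Γ) ≤ topEntropy Γ X :=
  le_iSup₂ (f := fun (U : Set (Set X)) (_ : IsOpenCoverOf U) =>
    limsup (fun F : Finset Γ =>
      ENNReal.log (minCoverCard (coverJoin U F) : ℝ≥0∞) / ((F.card : ℝ) : EReal))
      (leftFolnerFilter Γ)) U hU

theorem eventually_exists_subcover_card_le {M : ℝ} (hM : topEntropy Γ X < M) {U : Set (Set X)}
    (hU : IsOpenCoverOf U) : ∀ᶠ F in leftFolnerFilter Γ, ∃ V : Finset (Set X),
      (V : Set (Set X)) ⊆ coverJoin U F ∧ ⋃₀ (V : Set (Set X)) = Set.univ ∧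
        (V.card : ℝ) ≤ Real.exp (M * F.card) := by
  filter_upwards [eventually_lt_of_limsup_lt
    ((limsup_log_minCoverCard_le_topEntropy hU).trans_lt hM),
    eventually_nonempty_leftFolnerFilter] with F hF hne
  have hpos : (0 : EReal) < ((F.card : ℝ) : EReal) := by exact_mod_cast hne.card_pos
  have hlog : ENNReal.log (minCoverCard (coverJoin U F) : ℝ≥0∞) ≤ ((M * F.card : ℝ) : EReal) := by
    rw [mul_comm, EReal.coe_mul]
    exact (EReal.div_le_iff_le_mul hpos (EReal.coe_ne_top _)).1 hF.le
  have htop : minCoverCard (coverJoin U F) ≠ ⊤ := by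
    intro h
    rw [h, ENat.toENNReal_top, ENNReal.log_top, top_le_iff] at hlog
    exact EReal.coe_ne_top _ hlog
  obtain ⟨V, hVU, hcov, hcard⟩ := exists_subcover_card_eq_minCoverCard htop
  refine ⟨V, hVU, hcov, ?_⟩
  rw [hcard, ENat.toENNReal_coe, ← Real.log_exp (M * F.card),
    ← ENNReal.log_ofReal_of_pos (Real.exp_pos _), ENNReal.log_le_log_iff,
    ← ENNReal.ofReal_natCast, ENNReal.ofReal_le_ofReal_iff (Real.exp_pos _).le] at hlog
  exact hlog

theorem topEntropy_le_of_correspondence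
    (h : ∀ U : Set (Set X), IsOpenCoverOf U → ∃ V : Set (Set Y), IsOpenCoverOf V ∧
      ∀ δ : ℝ, 0 < δ → ∀ᶠ F in leftFolnerFilter Γ, ∃ R : X → Y → Prop, (∀ x, ∃ y, R x y) ∧
        ∀ v ∈ coverJoin V F,
          IsCoveredBy (coverJoin U F) (Real.exp (δ * F.card)) {x | ∃ y ∈ v, R x y}) :
    topEntropy Γ X ≤ topEntropy Γ Y := by
  refine iSup₂_le fun U hU => ?_
  obtain ⟨V, hV, hUV⟩ := h U hU
  refine le_trans (limsup_le_limsup_of_forall_pos_eventually_le_add fun δ hδ => ?_)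
    (limsup_log_minCoverCard_le_topEntropy hV)
  filter_upwards [hUV δ hδ, eventually_nonempty_leftFolnerFilter] with F ⟨R, hR, hRF⟩ hne
  have hpos : (0 : ℝ) < F.card := by exact_mod_cast hne.card_pos
  have hnn : (0 : EReal) ≤ ((F.card : ℝ) : EReal) := by exact_mod_cast hpos.le
  have hle := minCoverCard_le_mul_of_correspondence (Real.exp_pos _) hR hRF
  refine (EReal.div_le_div_right_of_nonneg hnn (ENNReal.log_monotone hle)).trans_eq ?_
  rw [ENNReal.log_mul_add, EReal.add_div_of_nonneg_right hnn,
    ENNReal.log_ofReal_of_pos (Real.exp_pos _), Real.log_exp, ← EReal.coe_div,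
    mul_div_cancel_right₀ _ hpos.ne']

theorem topEntropy_le_of_factor {π : Y → X} (hc : Continuous π) (hsurj : Function.Surjective π)
    (hπ : ∀ (γ : Γ) y, π (γ • y) = γ • π y) : topEntropy Γ X ≤ topEntropy Γ Y := by
  refine topEntropy_le_of_correspondence fun U hU => ⟨Set.preimage π '' U, ⟨?_, ?_⟩,
    fun δ hδ => Eventually.of_forall fun F => ⟨fun x y => π y = x, hsurj, fun v hv => ?_⟩⟩
  · rintro _ ⟨u, hu, rfl⟩
    exact (hU.1 u hu).preimage hc
  · rw [Set.sUnion_image, ← Set.preimage_iUnion₂, ← Set.sUnion_eq_biUnion, hU.2,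
      Set.preimage_univ]
  · obtain ⟨t, ht, rfl⟩ := exists_eq_preimage_of_mem_coverJoin hπ hv
    refine ⟨{t}, by simpa using ht, ?_, ?_⟩
    · simpa using mul_nonneg hδ.le (Nat.cast_nonneg F.card)
    · rintro _ ⟨y, hy, rfl⟩
      simpa using hy

end Entropy

section Coordinates

variable {Γ X M : Type*}

theorem exists_finset_forall_dist_lt_of_mem_uniformity [PseudoMetricSpace M]
    {V : Set ((Γ → M) × (Γ → M))} (hV : V ∈ uniformity (Γ → M)) :
    ∃ (K : Finset Γ) (ε : ℝ), 0 < ε ∧ ∀ x y, (∀ k ∈ K, dist (x k) (y k) < ε) → (x, y) ∈ V := by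
  rw [Pi.uniformity, (HasBasis.iInf' fun k =>
    Metric.uniformity_basis_dist.comap fun a : (Γ → M) × (Γ → M) => (a.1 k, a.2 k)).mem_iff] at hV
  obtain ⟨⟨I, r⟩, ⟨hI, hr⟩, hIV⟩ := hV
  obtain ⟨ε, hεr, hε⟩ := (((eventually_all_finite hI).2 fun k hk =>
    (eventually_lt_nhds (hr k hk)).filter_mono nhdsWithin_le_nhds).and
      (self_mem_nhdsWithin (s := Set.Ioi (0 : ℝ)))).exists
  exact ⟨hI.toFinset, ε, hε, fun x y hxy => hIV (Set.mem_iInter₂.2 fun k hk =>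
    (hxy k (hI.mem_toFinset.2 hk)).trans (hεr k hk))⟩

theorem exists_lebesgue_of_injective [MetricSpace M] [TopologicalSpace X] [CompactSpace X]
    {c : X → Γ → M} (hc : Continuous c) (hinj : Function.Injective c) {U : Set (Set X)}
    (hU : IsOpenCoverOf U) : ∃ (K : Finset Γ) (ε : ℝ), 0 < ε ∧
      ∀ x, ∃ u ∈ U, ∀ x', (∀ k ∈ K, dist (c x k) (c x' k) < ε) → x' ∈ u := by
  let _ : UniformSpace X := (hc.isClosedEmbedding hinj).isEmbedding.comapUniformSpace c
  obtain ⟨V, hV, hVU⟩ := lebesgue_number_lemma_sUnion isCompact_univ hU.1 hU.2.ge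
  obtain ⟨W, hW, hWV⟩ := mem_comap.1 hV
  obtain ⟨K, ε, hε, hK⟩ := exists_finset_forall_dist_lt_of_mem_uniformity hW
  refine ⟨K, ε, hε, fun x => ?_⟩
  obtain ⟨u, hu, hxu⟩ := hVU x (Set.mem_univ x)
  exact ⟨u, hu, fun x' hx' => hxu (hWV (hK _ _ hx'))⟩

/-- The open sets on which each of the coordinates `c · k`, `k ∈ K`, varies by less than `ε`. -/
def smallCover [PseudoMetricSpace M] [TopologicalSpace X] (c : X → Γ → M) (K : Finset Γ) (ε : ℝ) :
    Set (Set X) :=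
  {u | IsOpen u ∧ ∀ x ∈ u, ∀ x' ∈ u, ∀ k ∈ K, dist (c x k) (c x' k) < ε}

theorem isOpenCoverOf_smallCover [PseudoMetricSpace M] [TopologicalSpace X] {c : X → Γ → M}
    (hc : Continuous c) (K : Finset Γ) {ε : ℝ} (hε : 0 < ε) :
    IsOpenCoverOf (smallCover c K ε) := by
  refine ⟨fun u hu => hu.1, Set.eq_univ_of_forall fun x =>
    ⟨⋂ k ∈ K, {y | dist (c y k) (c x k) < ε / 2}, ⟨?_, fun y hy y' hy' k hk => ?_⟩, ?_⟩⟩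
  · exact isOpen_biInter_finset fun k _ =>
      isOpen_lt (((continuous_apply k).comp hc).dist continuous_const) continuous_const
  · calc dist (c y k) (c y' k) ≤ dist (c y k) (c x k) + dist (c y' k) (c x k) :=
          dist_triangle_right _ _ _
      _ < ε / 2 + ε / 2 := add_lt_add (Set.mem_iInter₂.1 hy k hk) (Set.mem_iInter₂.1 hy' k hk)
      _ = ε := add_halves ε
  · exact Set.mem_iInter₂.2 fun k _ => (dist_self (c x k)).trans_lt (half_pos hε)

variable [Group Γ] [MulAction Γ X] [TopologicalSpace X] {c : X → Γ → M}

open scoped Classical in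
theorem dist_lt_of_mem_coverJoin_smallCover [PseudoMetricSpace M]
    (hshift : ∀ (γ : Γ) x, c (γ • x) = leftShift γ (c x)) {K F : Finset Γ} {ε : ℝ} {v : Set X}
    (hv : v ∈ coverJoin (smallCover c K ε) F) {x x' : X} (hx : x ∈ v) (hx' : x' ∈ v) {γ : Γ}
    (hγ : γ ∈ F⁻¹ * K) : dist (c x γ) (c x' γ) < ε := by
  obtain ⟨φ, hφ, rfl⟩ := hv
  obtain ⟨g, hg, k, hk, rfl⟩ := Finset.mem_mul.1 hγ
  rw [Finset.mem_inv'] at hg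
  have h := (hφ g⁻¹ hg).2 _ (Set.mem_iInter₂.1 hx g⁻¹ hg) _ (Set.mem_iInter₂.1 hx' g⁻¹ hg) k hk
  simpa only [hshift, leftShift, inv_inv] using h

open scoped Classical in
theorem exists_mem_coverJoin_of_injective [MetricSpace M] [CompactSpace X] (hc : Continuous c)
    (hinj : Function.Injective c) (hshift : ∀ (γ : Γ) x, c (γ • x) = leftShift γ (c x))
    {U : Set (Set X)} (hU : IsOpenCoverOf U) : ∃ (K : Finset Γ) (ε : ℝ), 0 < ε ∧
      ∀ (F : Finset Γ) x, ∃ s ∈ coverJoin U F,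
        ∀ x', (∀ γ ∈ F⁻¹ * K, dist (c x γ) (c x' γ) < ε) → x' ∈ s := by
  obtain ⟨K, ε, hε, hK⟩ := exists_lebesgue_of_injective hc hinj hU
  refine ⟨K, ε, hε, fun F x => ?_⟩
  choose φ hφU hφ using fun γ : Γ => hK (γ • x)
  refine ⟨_, ⟨φ, fun γ _ => hφU γ, rfl⟩, fun x' hx' =>
    Set.mem_iInter₂.2 fun γ hγ => hφ γ (γ • x') fun k hk => ?_⟩
  simpa only [hshift, leftShift] using hx' _ (Finset.mul_mem_mul (Finset.inv_mem_inv hγ) hk)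

end Coordinates

/-! ### Counting in finite-dimensional spaces -/

section Counting

open MeasureTheory Module
open scoped NNReal

variable {E : Type*} [NormedAddCommGroup E] [NormedSpace ℝ E] [FiniteDimensional ℝ E]

theorem pow_finrank_le_card_mul_of_subset_biUnion_closedBall {r ε : ℝ} (hr : 0 ≤ r) (hε : 0 ≤ ε)
    {V : Finset E} (hV : Metric.closedBall 0 r ⊆ ⋃ c ∈ V, Metric.closedBall c ε) :
    r ^ finrank ℝ E ≤ V.card * ε ^ finrank ℝ E := by
  borelize E
  let μ : Measure E := Measure.addHaar
  have hfin : μ (⋃ c ∈ V, Metric.closedBall c ε) ≠ ⊤ :=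
    (measure_biUnion_lt_top V.finite_toSet fun c _ => measure_closedBall_lt_top).ne
  have hpos : 0 < μ.real (Metric.ball 0 1) :=
    ENNReal.toReal_pos (Metric.measure_ball_pos μ 0 one_pos).ne' measure_ball_lt_top.ne
  refine le_of_mul_le_mul_right ?_ hpos
  calc r ^ finrank ℝ E * μ.real (Metric.ball 0 1)
      = μ.real (Metric.closedBall 0 r) := (Measure.addHaar_real_closedBall μ 0 hr).symm
    _ ≤ μ.real (⋃ c ∈ V, Metric.closedBall c ε) := measureReal_mono hV hfin
    _ ≤ ∑ c ∈ V, μ.real (Metric.closedBall c ε) := measureReal_biUnion_finset_le _ _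
    _ = V.card * ε ^ finrank ℝ E * μ.real (Metric.ball 0 1) := by
      simp only [Measure.addHaar_real_closedBall μ _ hε, Finset.sum_const, nsmul_eq_mul, mul_assoc]

theorem card_mul_pow_finrank_le_of_pairwiseDisjoint_closedBall {r ε : ℝ} (hr : 0 ≤ r)
    (hε : 0 ≤ ε) {V : Finset E} (hV : ∀ c ∈ V, ‖c‖ ≤ r)
    (hdisj : (V : Set E).PairwiseDisjoint fun c => Metric.closedBall c ε) :
    V.card * ε ^ finrank ℝ E ≤ (r + ε) ^ finrank ℝ E := by
  borelize E
  let μ : Measure E := Measure.addHaar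
  have hsub : (⋃ c ∈ V, Metric.closedBall c ε) ⊆ Metric.closedBall 0 (r + ε) :=
    Set.iUnion₂_subset fun c hc => Metric.closedBall_subset_closedBall' (by
      rw [dist_zero_right, add_comm]
      exact add_le_add_left (hV c hc) ε)
  have hpos : 0 < μ.real (Metric.ball 0 1) :=
    ENNReal.toReal_pos (Metric.measure_ball_pos μ 0 one_pos).ne' measure_ball_lt_top.ne
  refine le_of_mul_le_mul_right ?_ hpos
  calc V.card * ε ^ finrank ℝ E * μ.real (Metric.ball 0 1)
      = ∑ c ∈ V, μ.real (Metric.closedBall c ε) := by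
        simp only [Measure.addHaar_real_closedBall μ _ hε, Finset.sum_const, nsmul_eq_mul,
          mul_assoc]
    _ = μ.real (⋃ c ∈ V, Metric.closedBall c ε) :=
        (measureReal_biUnion_finset hdisj (fun _ _ => Metric.isClosed_closedBall.measurableSet)
          fun _ _ => measure_closedBall_lt_top.ne).symm
    _ ≤ μ.real (Metric.closedBall 0 (r + ε)) :=
        measureReal_mono hsub measure_closedBall_lt_top.ne
    _ = (r + ε) ^ finrank ℝ E * μ.real (Metric.ball 0 1) :=
        Measure.addHaar_real_closedBall μ 0 (add_nonneg hr hε)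

theorem card_le_pow_finrank_of_isSeparated {r : ℝ} {ε : ℝ≥0} (hr : 0 ≤ r) (hε : 0 < ε)
    {V : Finset E} (hV : ∀ c ∈ V, ‖c‖ ≤ r) (hsep : Metric.IsSeparated ε (V : Set E)) :
    (V.card : ℝ) ≤ (1 + 2 * r / ε) ^ finrank ℝ E := by
  have hε2 : (0 : ℝ) < ε / 2 := by positivity
  have hle := card_mul_pow_finrank_le_of_pairwiseDisjoint_closedBall hr hε2.le hV
    fun x hx y hy hxy => Metric.closedBall_disjoint_closedBall (by
      rw [add_halves]
      have : (ε : ℝ≥0∞) < edist x y := hsep hx hy hxy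
      rw [edist_nndist, ENNReal.coe_lt_coe] at this
      exact_mod_cast this)
  rw [show r + (ε : ℝ) / 2 = (1 + 2 * r / ε) * (ε / 2) by field_simp; ring, mul_pow] at hle
  exact le_of_mul_le_mul_right hle (by positivity)

theorem exists_finset_closedBall_subset_biUnion_closedBall {r ε : ℝ} (hr : 0 ≤ r) (hε : 0 < ε) :
    ∃ D : Finset E, (D.card : ℝ) ≤ (1 + 2 * r / ε) ^ finrank ℝ E ∧
      Metric.closedBall 0 r ⊆ ⋃ c ∈ D, Metric.closedBall c ε := by
  lift ε to ℝ≥0 using hε.le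
  set B : Set E := Metric.closedBall 0 r
  have hpack : Metric.packingNumber ε B ≤ ⌊(1 + 2 * r / ε) ^ finrank ℝ E⌋₊ := by
    refine iSup_le fun C => iSup₂_le fun hCB hsep => ENat.forall_natCast_le_iff_le.1 fun n hn => ?_
    obtain ⟨t, htC, htn⟩ := Set.exists_subset_encard_eq hn
    lift t to Finset E using Set.finite_of_encard_eq_coe htn
    rw [Set.encard_coe_eq_coe_finsetCard, Nat.cast_inj] at htn
    rw [← htn, Nat.cast_le]
    exact Nat.le_floor (card_le_pow_finrank_of_isSeparated hr hε
      (fun c hc => mem_closedBall_zero_iff.1 (hCB (htC hc))) (hsep.mono htC))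
  have hcover := (Metric.coveringNumber_le_packingNumber ε B).trans hpack
  obtain ⟨D, -, hD, hBD, hcard⟩ := Metric.exists_set_encard_eq_coveringNumber
    (hcover.trans_lt (ENat.natCast_lt_top _)).ne
  lift D to Finset E using hD
  rw [← hcard, Set.encard_coe_eq_coe_finsetCard, Nat.cast_le] at hcover
  exact ⟨D, (Nat.cast_le.2 hcover).trans (Nat.floor_le (by positivity)),
    Metric.isCover_iff_subset_iUnion_closedBall.1 hBD⟩

end Counting

section ThresholdSets

variable {α : Type*} [Fintype α]

open scoped Classical in
/-- The sets `{a | t a ≤ w a}` for `w` in a space `W` of functions. -/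
def thresholdSets (W : Submodule ℝ (α → ℝ)) (t : α → ℝ) : Finset (Finset α) :=
  Finset.univ.filter fun s => ∃ w ∈ W, s = Finset.univ.filter fun a => t a ≤ w a

theorem filter_le_mem_thresholdSets {W : Submodule ℝ (α → ℝ)} (t : α → ℝ) {w : α → ℝ}
    (hw : w ∈ W) : (Finset.univ.filter fun a => t a ≤ w a) ∈ thresholdSets W t := by
  classical exact Finset.mem_filter.2 ⟨Finset.mem_univ _, w, hw, rfl⟩

theorem exists_mem_forall_iff_of_shatters_thresholdSets [DecidableEq α]
    {W : Submodule ℝ (α → ℝ)} {t : α → ℝ} {B : Finset α}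
    (hB : (thresholdSets W t).Shatters B) (P : α → Prop) :
    ∃ w ∈ W, ∀ b ∈ B, t b ≤ w b ↔ P b := by
  classical
  obtain ⟨u, hu, hBu⟩ := hB (Finset.filter_subset P B)
  obtain ⟨w, hw, rfl⟩ := (Finset.mem_filter.1 hu).2
  refine ⟨w, hw, fun b hb => ?_⟩
  have := Finset.ext_iff.1 hBu b
  simpa only [Finset.mem_inter, Finset.mem_filter, Finset.mem_univ, true_and, hb] using this

/-- Shattering realizes both sign patterns of a linear relation `∑ g_b w_b = 0` between the
coordinates: it yields `w, w' ∈ W` with `w_b ≥ t_b > w'_b` where `g_b > 0`, and conversely where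
`g_b < 0`, so that `∑ g_b (w_b - w'_b) = 0` has no negative term. -/
theorem card_le_finrank_of_shatters_thresholdSets [DecidableEq α] {W : Submodule ℝ (α → ℝ)}
    {t : α → ℝ} {B : Finset α} (hB : (thresholdSets W t).Shatters B) :
    B.card ≤ Module.finrank ℝ W := by
  let ev : B → Module.Dual ℝ W := fun b => (LinearMap.proj b.1).comp W.subtype
  suffices LinearIndependent ℝ ev by
    simpa only [Fintype.card_coe, Subspace.dual_finrank_eq] using this.fintype_card_le_finrank
  refine Fintype.linearIndependent_iff.2 fun g hg => ?_
  have hrel : ∀ w ∈ W, ∑ b, g b * w b = 0 := fun w hw => by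
    simpa [ev] using LinearMap.congr_fun hg ⟨w, hw⟩
  obtain ⟨w, hw, hwB⟩ := exists_mem_forall_iff_of_shatters_thresholdSets hB
    fun a => ∃ h : a ∈ B, 0 < g ⟨a, h⟩
  obtain ⟨w', hw', hwB'⟩ := exists_mem_forall_iff_of_shatters_thresholdSets hB
    fun a => ∃ h : a ∈ B, g ⟨a, h⟩ < 0
  have hpos : ∀ b : B, t b ≤ w b ↔ 0 < g b := fun b => by simpa using hwB b b.2
  have hneg : ∀ b : B, t b ≤ w' b ↔ g b < 0 := fun b => by simpa using hwB' b b.2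
  have hlt : ∀ b : B, g b ≠ 0 → 0 < g b * (w b - w' b) := fun b hb => by
    rcases hb.lt_or_gt with h | h
    · refine mul_pos_of_neg_of_neg h (sub_neg.2 ?_)
      exact (not_le.1 (mt (hpos b).1 h.not_gt)).trans_le ((hneg b).2 h)
    · refine mul_pos h (sub_pos.2 ?_)
      exact (not_le.1 (mt (hneg b).1 h.not_gt)).trans_le ((hpos b).2 h)
  have hnonneg : ∀ b : B, 0 ≤ g b * (w b - w' b) := fun b => by
    by_cases hb : g b = 0
    · rw [hb, zero_mul]
    · exact (hlt b hb).le
  have hsum : ∑ b, g b * (w b - w' b) = 0 := by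
    simp only [mul_sub, Finset.sum_sub_distrib, hrel w hw, hrel w' hw', sub_zero]
  intro b
  by_contra hb
  exact (hlt b hb).ne'
    ((Finset.sum_eq_zero_iff_of_nonneg fun b _ => hnonneg b).1 hsum b (Finset.mem_univ b))

theorem sum_choose_mul_pow_le (n d : ℕ) {t : ℝ} (ht : 0 ≤ t) (ht1 : t ≤ 1) :
    (∑ k ∈ Finset.Iic d, (n.choose k : ℝ)) * t ^ d ≤ (1 + t) ^ n := by
  have hvanish : ∀ k ∈ Finset.Iic d ∪ Finset.range (n + 1), k ∉ Finset.range (n + 1) →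
      (n.choose k : ℝ) * t ^ k = 0 := fun k _ hk => by
      rw [Nat.choose_eq_zero_of_lt (by simpa using hk), Nat.cast_zero, zero_mul]
  calc (∑ k ∈ Finset.Iic d, (n.choose k : ℝ)) * t ^ d
      ≤ ∑ k ∈ Finset.Iic d, (n.choose k : ℝ) * t ^ k := by
        rw [Finset.sum_mul]
        exact Finset.sum_le_sum fun k hk => mul_le_mul_of_nonneg_left
          (pow_le_pow_of_le_one ht ht1 (Finset.mem_Iic.1 hk)) (Nat.cast_nonneg _)
    _ ≤ ∑ k ∈ Finset.range (n + 1), (n.choose k : ℝ) * t ^ k :=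
        (Finset.sum_le_sum_of_subset_of_nonneg Finset.subset_union_left fun _ _ _ => by
          positivity).trans (Finset.sum_subset Finset.subset_union_right hvanish).symm.le
    _ = (1 + t) ^ n := by
        rw [add_comm 1 t, add_pow]
        exact Finset.sum_congr rfl fun k _ => by rw [one_pow, mul_one, mul_comm]

theorem card_thresholdSets_mul_pow_le (W : Submodule ℝ (α → ℝ)) (t : α → ℝ) {τ : ℝ}
    (hτ : 0 ≤ τ) (hτ1 : τ ≤ 1) :
    ((thresholdSets W t).card : ℝ) * τ ^ Module.finrank ℝ W ≤
      Real.exp (τ * Fintype.card α) := by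
  classical
  have hvc : (thresholdSets W t).vcDim ≤ Module.finrank ℝ W := Finset.sup_le fun B hB =>
    card_le_finrank_of_shatters_thresholdSets (by convert Finset.mem_shatterer.1 hB)
  have hcard : (thresholdSets W t).card ≤
      ∑ k ∈ Finset.Iic (Module.finrank ℝ W), (Fintype.card α).choose k :=
    (Finset.card_le_card_shatterer _).trans (Finset.card_shatterer_le_sum_vcDim.trans
      (Finset.sum_le_sum_of_subset (Finset.Iic_subset_Iic.2 hvc)))
  calc ((thresholdSets W t).card : ℝ) * τ ^ Module.finrank ℝ W
      ≤ (∑ k ∈ Finset.Iic (Module.finrank ℝ W), ((Fintype.card α).choose k : ℝ)) *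
          τ ^ Module.finrank ℝ W :=
        mul_le_mul_of_nonneg_right (by exact_mod_cast hcard) (by positivity)
    _ ≤ (1 + τ) ^ Fintype.card α := sum_choose_mul_pow_le _ _ hτ hτ1
    _ ≤ Real.exp τ ^ Fintype.card α := by
        gcongr
        rw [add_comm]
        exact Real.add_one_le_exp τ
    _ = Real.exp (τ * Fintype.card α) := by rw [mul_comm, Real.exp_nat_mul]

end ThresholdSets

/-! ### The spaces `X_f`, `Ȳ_f` and `Z̄_f` -/

namespace EllInf

variable {Γ : Type*} {C : ℝ}

theorem continuous_eval (γ : Γ) : Continuous fun v : EllInf Γ => v.1 γ := by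
  classical
  have hh : Memℓp (Pi.single γ (1 : ℝ) : Γ → ℝ) 1 := by
    refine (memℓp_gen_iff (by simp)).2 (summable_of_ne_finset_zero (s := {γ}) fun δ hδ => ?_)
    rw [Pi.single_eq_of_ne (by simpa using hδ)]
    simp
  have hd : Continuous (fun (v : EllInf Γ) (h : {h : Γ → ℝ // Memℓp h 1}) =>
      ∑' δ, h.1 δ * v.1 δ) := continuous_induced_dom
  refine ((continuous_apply (⟨_, hh⟩ : {h : Γ → ℝ // Memℓp h 1})).comp hd).congr fun v => ?_
  change ∑' δ, (Pi.single γ (1 : ℝ) : Γ → ℝ) δ * v.1 δ = v.1 γ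
  rw [tsum_eq_single γ fun δ hδ => by rw [Pi.single_eq_of_ne hδ, zero_mul], Pi.single_eq_same,
    one_mul]

theorem continuous_val : Continuous fun v : EllInf Γ => v.1 :=
  continuous_pi continuous_eval

theorem memℓp_of_abs_le {v : Γ → ℝ} (hv : ∀ γ, |v γ| ≤ C) : Memℓp v ∞ :=
  memℓp_infty ⟨C, Set.forall_mem_range.2 hv⟩

/-- A function bounded by `C`, as an element of `ℓ^∞`. On these functions the weak* topology is
the topology of pointwise convergence. -/
def ofBounded (C : ℝ) (v : {v : Γ → ℝ // ∀ γ, |v γ| ≤ C}) : EllInf Γ :=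
  ⟨v.1, memℓp_of_abs_le v.2⟩

theorem continuous_ofBounded (C : ℝ) : Continuous (ofBounded (Γ := Γ) C) := by
  refine continuous_induced_rng.2 (continuous_pi fun h => ?_)
  have hs : Summable fun γ => |h.1 γ| * C := by
    have := (memℓp_gen_iff (by simp)).1 h.2
    simp only [ENNReal.toReal_one, Real.rpow_one, Real.norm_eq_abs] at this
    exact this.mul_right C
  refine continuous_tsum (fun γ => ?_) hs fun γ v => ?_
  · exact continuous_const.mul ((continuous_apply γ).comp continuous_subtype_val)
  · rw [Real.norm_eq_abs, abs_mul]
    exact mul_le_mul_of_nonneg_left (v.2 γ) (abs_nonneg _)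

theorem isClosed_setOf_abs_le (C : ℝ) : IsClosed {v : EllInf Γ | ∀ γ, |v.1 γ| ≤ C} := by
  rw [Set.ofPred_forall]
  exact isClosed_iInter fun γ => isClosed_le (continuous_eval γ).abs continuous_const

theorem isCompact_setOf_abs_le (C : ℝ) : IsCompact {v : EllInf Γ | ∀ γ, |v.1 γ| ≤ C} := by
  have hpi : IsCompact {v : Γ → ℝ | ∀ γ, |v γ| ≤ C} := by
    convert isCompact_univ_pi fun _ : Γ => isCompact_Icc (a := -C) (b := C) using 1
    ext v
    simp only [Set.mem_ofPred_eq, Set.mem_univ_pi, Set.mem_Icc, abs_le]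
  have : CompactSpace {v : Γ → ℝ // ∀ γ, |v γ| ≤ C} := isCompact_iff_compactSpace.1 hpi
  convert isCompact_range (continuous_ofBounded (Γ := Γ) C) using 1
  ext v
  exact ⟨fun hv => ⟨⟨v.1, hv⟩, rfl⟩, fun ⟨w, hw⟩ => hw ▸ w.2⟩

theorem isCompact_closure_of_abs_le {Y : Set (EllInf Γ)} (hY : ∀ v ∈ Y, ∀ γ, |v.1 γ| ≤ C) :
    IsCompact (closure Y) :=
  (isCompact_setOf_abs_le C).of_isClosed_subset isClosed_closure
    (closure_minimal hY (isClosed_setOf_abs_le C))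

theorem continuous_etaMap : Continuous (etaMap : EllInf Γ → Γ → UnitAddCircle) :=
  continuous_pi fun γ => (AddCircle.continuous_mk' 1).comp (continuous_eval γ)

end EllInf

section RightConv

/-- The norm `‖f‖₁ = ∑_γ |f_γ|`. -/
def ellOneNorm {Γ : Type*} (f : MonoidAlgebra ℤ Γ) : ℝ :=
  ∑ δ ∈ f.coeff.support, |(f.coeff δ : ℝ)|

variable {Γ A B : Type*} [Group Γ] [AddCommGroup A] [AddCommGroup B] (f : MonoidAlgebra ℤ Γ)

theorem rightConv_add (x y : Γ → A) : rightConv f (x + y) = rightConv f x + rightConv f y := by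
  funext γ
  simp [rightConv, Finset.sum_add_distrib]

theorem rightConv_sub (x y : Γ → A) : rightConv f (x - y) = rightConv f x - rightConv f y := by
  funext γ
  simp [rightConv, smul_sub, Finset.sum_sub_distrib]

theorem rightConv_map (g : A →+ B) (x : Γ → A) (γ : Γ) :
    rightConv f (fun δ => g (x δ)) γ = g (rightConv f x γ) := by
  simp [rightConv, map_sum, map_zsmul]

theorem rightConv_intCast (m : Γ → ℤ) (γ : Γ) :
    rightConv f (fun δ => (m δ : ℝ)) γ = (rightConv f m γ : ℤ) :=
  rightConv_map f (Int.castAddHom ℝ) m γ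

variable {f} in
theorem rightConv_congr {x y : Γ → A} {γ : Γ}
    (h : ∀ δ ∈ f.coeff.support, x (γ * δ) = y (γ * δ)) : rightConv f x γ = rightConv f y γ :=
  Finset.sum_congr rfl fun δ hδ => by rw [h δ hδ]

theorem continuous_rightConv [TopologicalSpace A] [IsTopologicalAddGroup A] :
    Continuous (rightConv f : (Γ → A) → Γ → A) :=
  continuous_pi fun γ => continuous_finsetSum _ fun δ _ => (continuous_apply (γ * δ)).zsmul _

variable {f} in
theorem abs_rightConv_le {C : ℝ} {v : Γ → ℝ} {γ : Γ}
    (hv : ∀ δ ∈ f.coeff.support, |v (γ * δ)| ≤ C) : |rightConv f v γ| ≤ ellOneNorm f * C := by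
  rw [ellOneNorm, Finset.sum_mul]
  refine (Finset.abs_sum_le_sum_abs _ _).trans (Finset.sum_le_sum fun δ hδ => ?_)
  rw [zsmul_eq_mul, abs_mul]
  exact mul_le_mul_of_nonneg_left (hv δ hδ) (abs_nonneg _)

end RightConv

section Spaces

variable {Γ : Type*} [Group Γ] {f : MonoidAlgebra ℤ Γ}

theorem coe_mem_Xf_iff {v : Γ → ℝ} :
    (fun γ => (v γ : UnitAddCircle)) ∈ Xf f ↔ ∀ γ, ∃ n : ℤ, (n : ℝ) = rightConv f v γ := by
  change rightConv f _ = 0 ↔ _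
  rw [funext_iff]
  refine forall_congr' fun γ => ?_
  have hcoe : rightConv f (fun δ => (v δ : UnitAddCircle)) γ = (rightConv f v γ : ℝ) :=
    rightConv_map f (QuotientAddGroup.mk' (AddSubgroup.zmultiples (1 : ℝ))) v γ
  rw [hcoe, Pi.zero_apply, AddCircle.coe_eq_zero_iff]
  simp only [zsmul_eq_mul, mul_one]

theorem isClosed_Xf : IsClosed (Xf f) :=
  isClosed_singleton.preimage (continuous_rightConv f)

theorem abs_le_one_of_mem_Yf {y : EllInf Γ} (hy : y ∈ Yf f) (γ : Γ) : |y.1 γ| ≤ 1 :=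
  abs_le.2 ⟨by linarith [(hy.2 γ).1], (hy.2 γ).2.le⟩

theorem mem_Icc_of_mem_YfBar {y : EllInf Γ} (hy : y ∈ YfBar f) (γ : Γ) :
    y.1 γ ∈ Set.Icc (0 : ℝ) 1 :=
  closure_minimal (t := {v : EllInf Γ | v.1 γ ∈ Set.Icc (0 : ℝ) 1})
    (fun _ hw => Set.Ico_subset_Icc_self (hw.2 γ))
    (isClosed_Icc.preimage (EllInf.continuous_eval γ)) hy

instance YfBar.instCompactSpace : CompactSpace (YfBar f) :=
  isCompact_iff_compactSpace.1 (EllInf.isCompact_closure_of_abs_le fun _ => abs_le_one_of_mem_Yf)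

theorem abs_rightConv_le_of_mem_YfBar {y : EllInf Γ} (hy : y ∈ YfBar f) (γ : Γ) :
    |rightConv f y.1 γ| ≤ ellOneNorm f := by
  rw [← mul_one (ellOneNorm f)]
  refine abs_rightConv_le fun δ _ => ?_
  have h := mem_Icc_of_mem_YfBar hy (γ * δ)
  exact abs_le.2 ⟨by linarith [h.1], h.2⟩

theorem rhoBar_mem_ZfBar {y : EllInf Γ} (hy : y ∈ YfBar f) : rhoBar f y ∈ ZfBar f := by
  have hc : ContinuousOn (rhoBar f) (YfBar f) := by
    rw [continuousOn_iff_continuous_domRestrict]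
    exact (EllInf.continuous_ofBounded (ellOneNorm f)).comp
      (Continuous.subtype_mk ((continuous_rightConv f).comp
        (EllInf.continuous_val.comp continuous_subtype_val))
          fun y => abs_rightConv_le_of_mem_YfBar y.2)
  exact ContinuousOn.image_closure hc ⟨y, hy, rfl⟩

instance ZfBar.instCompactSpace : CompactSpace (ZfBar f) := by
  refine isCompact_iff_compactSpace.1
    (EllInf.isCompact_closure_of_abs_le (C := ellOneNorm f) ?_)
  rintro _ ⟨y, hy, rfl⟩
  exact abs_rightConv_le_of_mem_YfBar (subset_closure hy)

theorem exists_int_of_mem_ZfBar {z : EllInf Γ} (hz : z ∈ ZfBar f) (γ : Γ) :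
    ∃ n : ℤ, (n : ℝ) = z.1 γ := by
  refine closure_minimal (t := {v : EllInf Γ | v.1 γ ∈ Set.range ((↑) : ℤ → ℝ)}) ?_
    (Int.isClosedEmbedding_coe_real.isClosed_range.preimage (EllInf.continuous_eval γ)) hz
  rintro _ ⟨y, hy, rfl⟩
  exact coe_mem_Xf_iff.1 hy.1 γ

theorem eq_of_mem_ZfBar_of_dist_lt_one {z z' : EllInf Γ} (hz : z ∈ ZfBar f) (hz' : z' ∈ ZfBar f)
    {γ : Γ} (h : dist (z.1 γ) (z'.1 γ) < 1) : z.1 γ = z'.1 γ := by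
  obtain ⟨n, hn⟩ := exists_int_of_mem_ZfBar hz γ
  obtain ⟨n', hn'⟩ := exists_int_of_mem_ZfBar hz' γ
  rw [← hn, ← hn'] at h ⊢
  rw [Real.dist_eq] at h
  have hnn' : |n - n'| < 1 := by exact_mod_cast h
  rw [Int.abs_lt_one_iff, sub_eq_zero] at hnn'
  rw [hnn']

theorem exists_mem_Yf_eqOn_of_mem_ZfBar {z : EllInf Γ} (hz : z ∈ ZfBar f) (E : Finset Γ) :
    ∃ y ∈ Yf f, ∀ γ ∈ E, rightConv f y.1 γ = z.1 γ := by
  have hopen : IsOpen (⋂ γ ∈ E, {v : EllInf Γ | dist (v.1 γ) (z.1 γ) < 1}) :=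
    isOpen_biInter_finset fun γ _ =>
      isOpen_lt ((EllInf.continuous_eval γ).dist continuous_const) continuous_const
  obtain ⟨_, hv, y, hy, rfl⟩ := mem_closure_iff.1 hz _ hopen
    (Set.mem_iInter₂.2 fun γ _ => (dist_self (z.1 γ)).trans_lt one_pos)
  exact ⟨y, hy, fun γ hγ => eq_of_mem_ZfBar_of_dist_lt_one
    (rhoBar_mem_ZfBar (subset_closure hy)) hz (Set.mem_iInter₂.1 hv γ hγ)⟩

theorem etaMap_mem_Xf_of_mem_YfBar {y : EllInf Γ} (hy : y ∈ YfBar f) : etaMap y ∈ Xf f :=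
  closure_minimal (t := etaMap ⁻¹' Xf f) (fun _ hw => hw.1)
    (isClosed_Xf.preimage EllInf.continuous_etaMap) hy

theorem exists_mem_Yf_etaMap_eq {x : Γ → UnitAddCircle} (hx : x ∈ Xf f) :
    ∃ y ∈ Yf f, etaMap y = x := by
  let t : Γ → Set.Ico (0 : ℝ) (0 + 1) := fun γ => AddCircle.equivIco 1 0 (x γ)
  have ht : ∀ γ, (t γ : ℝ) ∈ Set.Ico (0 : ℝ) 1 := fun γ => by
    simpa only [zero_add] using (t γ).2
  let y : EllInf Γ := ⟨fun γ => t γ, EllInf.memℓp_of_abs_le (C := 1) fun γ =>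
    abs_le.2 ⟨by linarith [(ht γ).1], (ht γ).2.le⟩⟩
  have hy : etaMap y = x := funext fun γ => AddCircle.coe_equivIco
  exact ⟨y, ⟨by rwa [Wf, Set.mem_preimage, hy], ht⟩, hy⟩

theorem topEntropy_Xf_le_topEntropy_YfBar (f : MonoidAlgebra ℤ Γ) :
    topEntropy Γ (Xf f) ≤ topEntropy Γ (YfBar f) := by
  refine topEntropy_le_of_factor
    (π := fun y : YfBar f => (⟨etaMap y.1, etaMap_mem_Xf_of_mem_YfBar y.2⟩ : Xf f))
    ((EllInf.continuous_etaMap.comp continuous_subtype_val).subtype_mk _) ?_ fun γ y => rfl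
  rintro ⟨x, hx⟩
  obtain ⟨y, hy, rfl⟩ := exists_mem_Yf_etaMap_eq hx
  exact ⟨⟨y, subset_closure hy⟩, rfl⟩

end Spaces

/-! ### Finite-dimensional kernels of `ρ^f` -/

section Kernels

open Module

theorem extend_val_of_mem {Γ : Type*} {A : Finset Γ} (w : A → ℝ) {γ : Γ} (h : γ ∈ A) :
    Function.extend Subtype.val w 0 γ = w ⟨γ, h⟩ :=
  Subtype.val_injective.extend_apply w 0 ⟨γ, h⟩

theorem extend_val_of_notMem {Γ : Type*} {A : Finset Γ} (w : A → ℝ) {γ : Γ} (h : γ ∉ A) :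
    Function.extend Subtype.val w 0 γ = 0 :=
  Function.extend_apply' w (0 : Γ → ℝ) γ fun ⟨a, ha⟩ => h (ha ▸ a.2)

theorem extend_val_restrict {Γ : Type*} {A : Finset Γ} {u : Γ → ℝ} (hu : ∀ γ ∉ A, u γ = 0) :
    Function.extend Subtype.val (fun a : A => u a) 0 = u := by
  funext γ
  by_cases hγ : γ ∈ A
  · exact extend_val_of_mem _ hγ
  · rw [extend_val_of_notMem _ hγ, hu γ hγ]

variable {Γ : Type*} [Group Γ] (f : MonoidAlgebra ℤ Γ)

/-- `ρ^f` as a linear map on `ℝ^Γ`. -/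
def rightConvLinear : (Γ → ℝ) →ₗ[ℝ] (Γ → ℝ) where
  toFun := rightConv f
  map_add' := rightConv_add f
  map_smul' c x := by
    funext γ
    simp only [rightConv, Pi.smul_apply, smul_eq_mul, zsmul_eq_mul, RingHom.id_apply,
      Finset.mul_sum]
    exact Finset.sum_congr rfl fun δ _ => mul_left_comm _ _ _

/-- The functions on `A` whose extension by zero is mapped by `ρ^f` to a function vanishing
on `E`. They are functions on `A` rather than on `Γ` in order to form a finite-dimensional normed
space. -/
def kerOn (A : Finset Γ) (E : Set Γ) : Submodule ℝ (A → ℝ) :=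
  LinearMap.ker (LinearMap.funLeft ℝ ℝ (Subtype.val : E → Γ) ∘ₗ rightConvLinear f ∘ₗ
    Function.ExtendByZero.linearMap ℝ (Subtype.val : A → Γ))

variable {f} {A I K S F : Finset Γ} {E : Set Γ}

theorem mem_kerOn {w : A → ℝ} :
    w ∈ kerOn f A E ↔ ∀ γ ∈ E, rightConv f (Function.extend Subtype.val w 0) γ = 0 := by
  rw [kerOn, LinearMap.mem_ker, funext_iff, Subtype.forall]
  rfl

theorem restrict_mem_kerOn (hA : ∀ γ ∈ E, ∀ δ ∈ f.coeff.support, γ * δ ∈ A) {u : Γ → ℝ}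
    (hu : ∀ γ ∈ E, rightConv f u γ = 0) : (fun a : A => u a) ∈ kerOn f A E := by
  refine mem_kerOn.2 fun γ hγ => ?_
  rw [← hu γ hγ]
  exact rightConv_congr fun δ hδ => extend_val_of_mem _ (hA γ hγ δ hδ)

theorem restrict_mem_kerOn_univ (hI : ∀ γ, ∀ δ ∈ f.coeff.support, γ * δ ∈ I → γ ∈ E) {u : Γ → ℝ}
    (hu : ∀ γ ∈ E, rightConv f u γ = 0) (huI : ∀ γ ∉ I, u γ = 0) :
    (fun a : I => u a) ∈ kerOn f I Set.univ := by
  refine mem_kerOn.2 fun γ _ => ?_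
  rw [extend_val_restrict huI]
  by_cases hγ : γ ∈ E
  · exact hu γ hγ
  · exact Finset.sum_eq_zero fun δ hδ => by rw [huI _ fun h => hγ (hI γ δ hδ h), smul_zero]

open scoped Classical in
theorem finrank_kerOn_le (hI : ∀ γ, ∀ δ ∈ f.coeff.support, γ * δ ∈ I → γ ∈ E) :
    finrank ℝ (kerOn f A E) ≤ finrank ℝ (kerOn f I Set.univ) + (A \ I).card := by
  let ext : kerOn f A E →ₗ[ℝ] (Γ → ℝ) :=
    Function.ExtendByZero.linearMap ℝ (Subtype.val : A → Γ) ∘ₗ (kerOn f A E).subtype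
  have hext_inj : Function.Injective ext := fun w w' h => Subtype.ext <| funext fun a =>
    (extend_val_of_mem w.1 a.2).symm.trans ((congrFun h a).trans (extend_val_of_mem w'.1 a.2))
  let φ : kerOn f A E →ₗ[ℝ] ((A \ I : Finset Γ) → ℝ) :=
    LinearMap.funLeft ℝ ℝ Subtype.val ∘ₗ ext
  let ψ : LinearMap.ker φ →ₗ[ℝ] (I → ℝ) :=
    LinearMap.funLeft ℝ ℝ Subtype.val ∘ₗ ext ∘ₗ (LinearMap.ker φ).subtype
  have hvanish : ∀ w : LinearMap.ker φ, ∀ γ ∉ I, ext w.1 γ = 0 := by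
    intro w γ hγ
    by_cases hA : γ ∈ A
    · exact congrFun (LinearMap.mem_ker.1 w.2) ⟨γ, Finset.mem_sdiff.2 ⟨hA, hγ⟩⟩
    · exact extend_val_of_notMem _ hA
  have hψ : ∀ w, ψ w ∈ kerOn f I Set.univ := fun w =>
    restrict_mem_kerOn_univ hI (u := ext w.1) (mem_kerOn.1 w.1.2) (hvanish w)
  have hψ_inj : Function.Injective (ψ.codRestrict _ hψ) := by
    intro w w' h
    refine Subtype.ext (hext_inj ?_)
    have hψw : ψ w = ψ w' := congrArg Subtype.val h
    rw [← extend_val_restrict (hvanish w), ← extend_val_restrict (hvanish w')]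
    exact congrArg (fun u : I → ℝ => Function.extend Subtype.val u 0) hψw
  have hrank := LinearMap.finrank_range_add_finrank_ker φ
  have hrange : finrank ℝ (LinearMap.range φ) ≤ (A \ I).card := by
    simpa only [finrank_fintype_fun_eq_card, Fintype.card_coe] using
      Submodule.finrank_le (LinearMap.range φ)
  have hker := LinearMap.finrank_le_finrank_of_injective hψ_inj
  omega

theorem coe_extend_mem_Xf {w : I → ℝ} (hw : w ∈ kerOn f I Set.univ) :
    (fun γ => ((Function.extend Subtype.val w 0 γ : ℝ) : UnitAddCircle)) ∈ Xf f :=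
  coe_mem_Xf_iff.2 fun γ => ⟨0, by rw [mem_kerOn.1 hw γ (Set.mem_univ γ), Int.cast_zero]⟩

theorem dist_coe_unitAddCircle_of_abs_le {a b : ℝ} (ha : |a| ≤ 1 / 4) (hb : |b| ≤ 1 / 4) :
    dist (a : UnitAddCircle) (b : UnitAddCircle) = dist a b := by
  rw [dist_eq_norm, ← AddCircle.coe_sub, (AddCircle.norm_coe_eq_abs_iff 1 one_ne_zero).2,
    Real.dist_eq]
  rw [abs_one]
  linarith [abs_sub a b]

open scoped Classical in
theorem pow_finrank_kerOn_le_card_mul (hI : I ⊆ F⁻¹) {ε : ℝ} (hε : 0 ≤ ε)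
    {V : Finset (Set (Xf f))}
    (hV : (V : Set (Set (Xf f))) ⊆ coverJoin (smallCover Subtype.val {1} ε) F)
    (hcov : ⋃₀ (V : Set (Set (Xf f))) = Set.univ) :
    (1 / 4 : ℝ) ^ finrank ℝ (kerOn f I Set.univ) ≤
      V.card * ε ^ finrank ℝ (kerOn f I Set.univ) := by
  let π : kerOn f I Set.univ → Xf f := fun w => ⟨_, coe_extend_mem_Xf w.2⟩
  have hdist : ∀ v ∈ V, ∀ w ∈ Metric.closedBall 0 (1 / 4), ∀ w' ∈ Metric.closedBall 0 (1 / 4),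
      π w ∈ v → π w' ∈ v → dist w w' ≤ ε := by
    intro v hv w hw w' hw' hwv hwv'
    rw [mem_closedBall_zero_iff] at hw hw'
    refine (dist_pi_le_iff hε).2 fun a => ?_
    have h := dist_lt_of_mem_coverJoin_smallCover (fun _ _ => rfl) (hV hv) hwv hwv'
      (γ := a) (mul_one (a : Γ) ▸ Finset.mul_mem_mul (hI a.2) (Finset.mem_singleton_self 1))
    simp only [π, extend_val_of_mem _ a.2] at h
    rw [dist_coe_unitAddCircle_of_abs_le ((norm_le_pi_norm w.1 a).trans hw)
      ((norm_le_pi_norm w'.1 a).trans hw')] at h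
    exact h.le
  have hcenter : ∀ v : Set (Xf f), ∃ c : kerOn f I Set.univ, ∀ w ∈ Metric.closedBall 0 (1 / 4),
      π w ∈ v → c ∈ Metric.closedBall 0 (1 / 4) ∧ π c ∈ v := by
    intro v
    by_cases h : ∃ c ∈ Metric.closedBall 0 (1 / 4), π c ∈ v
    · exact ⟨h.choose, fun _ _ _ => h.choose_spec⟩
    · exact ⟨0, fun w hw hwv => absurd ⟨w, hw, hwv⟩ h⟩
  choose c hc using hcenter
  refine (pow_finrank_le_card_mul_of_subset_biUnion_closedBall (by norm_num) hε
    (V := V.image c) fun w hw => ?_).trans ?_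
  · obtain ⟨v, hv, hwv⟩ : π w ∈ ⋃₀ (V : Set (Set (Xf f))) := hcov ▸ Set.mem_univ _
    obtain ⟨hcb, hcv⟩ := hc v w hw hwv
    exact Set.mem_iUnion₂.2 ⟨c v, Finset.mem_image_of_mem c hv, hdist v hv w hw _ hcb hwv hcv⟩
  · gcongr
    exact Finset.card_image_le

open scoped Classical in
theorem eventually_finrank_kerOn_univ_le (hf : topEntropy Γ (Xf f) < ⊤) {c : ℝ} (hc : 0 < c) :
    ∀ᶠ F in leftFolnerFilter Γ, ∀ I ⊆ (F⁻¹ : Finset Γ),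
      (finrank ℝ (kerOn f I Set.univ) : ℝ) ≤ c * F.card := by
  obtain ⟨M, hM, -⟩ := EReal.lt_iff_exists_real_btwn.1 hf
  let L : ℝ := |M| / c + 1
  have hL : 0 < L := by positivity
  let ε : ℝ := Real.exp (-L) * (1 / 4)
  have hε : 0 < ε := by positivity
  filter_upwards [eventually_exists_subcover_card_le hM
    (isOpenCoverOf_smallCover continuous_subtype_val {1} hε)] with F ⟨V, hV, hcov, hVcard⟩ I hI
  set d := finrank ℝ (kerOn f I Set.univ)
  have hvol : (1 / 4 : ℝ) ^ d ≤ V.card * (Real.exp (-L) * (1 / 4)) ^ d :=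
    pow_finrank_kerOn_le_card_mul hI hε.le hV hcov
  have hexp : 1 ≤ Real.exp (M * F.card) * Real.exp (-L) ^ d := by
    rw [mul_pow, ← mul_assoc, le_mul_iff_one_le_left (by positivity)] at hvol
    exact hvol.trans (by gcongr)
  rw [← Real.exp_nat_mul, ← Real.exp_add, Real.one_le_exp_iff] at hexp
  have hdL : d * L ≤ |M| * F.card := by
    have := mul_le_mul_of_nonneg_right (le_abs_self M) (Nat.cast_nonneg (α := ℝ) F.card)
    linarith
  refine le_of_mul_le_mul_right (hdL.trans ?_) hL
  calc |M| * F.card ≤ (|M| + c) * F.card := by gcongr; linarith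
    _ = c * F.card * L := by simp only [L]; field_simp

open scoped Classical in
theorem eventually_card_biUnion_symmDiff_le (T : Finset Γ) {c : ℝ} (hc : 0 < c) :
    ∀ᶠ F in leftFolnerFilter Γ, ((T.biUnion fun γ => (γ • F) ∆ F).card : ℝ) ≤ c * F.card := by
  filter_upwards [eventually_mem_leftInvariantSets T
    (show 0 < c / (T.card + 1) by positivity)] with F hF
  calc ((T.biUnion fun γ => (γ • F) ∆ F).card : ℝ)
      ≤ ∑ γ ∈ T, (((γ • F) ∆ F).card : ℝ) := by exact_mod_cast Finset.card_biUnion_le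
    _ ≤ T.card • (c / (T.card + 1) * F.card) := Finset.sum_le_card_nsmul _ _ _ hF.2
    _ = T.card / (T.card + 1) * (c * F.card) := by rw [nsmul_eq_mul]; ring
    _ ≤ c * F.card :=
      mul_le_of_le_one_left (by positivity) ((div_le_one (by positivity)).2 (by linarith))

open scoped Classical in
/-- The inverse of the `S`-interior of `F`, the set of those `g ∈ F` with `S g ⊆ F`. Inverses occur
because the shift by `γ` moves the coordinate at `γ⁻¹` to `1`. -/
def invInterior (S F : Finset Γ) : Finset Γ := (F.filter fun g => ∀ s ∈ S, s * g ∈ F)⁻¹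

open scoped Classical in
theorem mem_invInterior {γ : Γ} :
    γ ∈ invInterior S F ↔ γ⁻¹ ∈ F ∧ ∀ s ∈ S, s * γ⁻¹ ∈ F := by
  rw [invInterior, Finset.mem_inv', Finset.mem_filter]

open scoped Classical in
theorem inv_mul_sdiff_invInterior_subset (K S F : Finset Γ) :
    (F⁻¹ * K) \ invInterior S F ⊆ ((K ∪ S)⁻¹.biUnion fun γ => (γ • F) ∆ F)⁻¹ := by
  intro γ hγ
  obtain ⟨hγK, hγS⟩ := Finset.mem_sdiff.1 hγ
  rw [mem_invInterior, not_and] at hγS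
  obtain ⟨g, hg, k, hk, rfl⟩ := Finset.mem_mul.1 hγK
  rw [Finset.mem_inv', Finset.mem_biUnion]
  by_cases hF : (g * k)⁻¹ ∈ F
  · obtain ⟨s, hs, hsF⟩ : ∃ s ∈ S, s * (g * k)⁻¹ ∉ F := by simpa using hγS hF
    refine ⟨s⁻¹, Finset.inv_mem_inv (Finset.mem_union_right _ hs),
      Finset.mem_symmDiff.2 (Or.inr ⟨hF, ?_⟩)⟩
    rwa [Finset.mem_inv_smul_finset_iff, smul_eq_mul]
  · refine ⟨k⁻¹, Finset.inv_mem_inv (Finset.mem_union_left _ hk),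
      Finset.mem_symmDiff.2 (Or.inl ⟨?_, hF⟩)⟩
    rwa [Finset.mem_inv_smul_finset_iff, smul_eq_mul, mul_inv_rev, mul_inv_cancel_left,
      ← Finset.mem_inv']

open scoped Classical in
/-- The kernels of `ρ^f` on the finite windows `F⁻¹ K`, with the equation `ρ^f u = 0` imposed on
`F⁻¹`, have dimension `o(|F|)` as `F` becomes more and more left invariant. -/
def HasSublinearKernels (f : MonoidAlgebra ℤ Γ) : Prop :=
  ∀ (K : Finset Γ) (c : ℝ), 0 < c → ∀ᶠ F in leftFolnerFilter Γ,
    (finrank ℝ (kerOn f (F⁻¹ * K) (F⁻¹ : Finset Γ)) : ℝ) ≤ c * F.card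

theorem hasSublinearKernels_of_topEntropy_lt_top (hf : topEntropy Γ (Xf f) < ⊤) :
    HasSublinearKernels f := by
  classical
  intro K c hc
  let S := f.coeff.support
  filter_upwards [eventually_finrank_kerOn_univ_le hf (half_pos hc),
    eventually_card_biUnion_symmDiff_le (K ∪ S)⁻¹ (half_pos hc)] with F hkernel hboundary
  have hinterior := hkernel (invInterior S F) fun γ hγ =>
    Finset.mem_inv'.2 (mem_invInterior.1 hγ).1
  have hrank : finrank ℝ (kerOn f (F⁻¹ * K) (F⁻¹ : Finset Γ)) ≤
      finrank ℝ (kerOn f (invInterior S F) Set.univ) + ((F⁻¹ * K) \ invInterior S F).card := by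
    refine finrank_kerOn_le fun γ δ hδ hγδ => Finset.mem_coe.2 (Finset.mem_inv'.2 ?_)
    have h := (mem_invInterior.1 hγδ).2 δ hδ
    rwa [mul_inv_rev, mul_inv_cancel_left] at h
  have hsdiff := Finset.card_le_card (inv_mul_sdiff_invInterior_subset K S F)
  rw [Finset.card_inv] at hsdiff
  calc (finrank ℝ (kerOn f (F⁻¹ * K) (F⁻¹ : Finset Γ)) : ℝ)
      ≤ finrank ℝ (kerOn f (invInterior S F) Set.univ) +
          ((K ∪ S)⁻¹.biUnion fun γ => (γ • F) ∆ F).card := by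
        exact_mod_cast hrank.trans (Nat.add_le_add_left hsdiff _)
    _ ≤ c / 2 * F.card + c / 2 * F.card := add_le_add hinterior hboundary
    _ = c * F.card := by ring

namespace HasSublinearKernels

open scoped Classical in
theorem eventually_pow_finrank_le (hf : HasSublinearKernels f) (K : Finset Γ) {R δ : ℝ}
    (hR : 0 < R) (hδ : 0 < δ) : ∀ᶠ F in leftFolnerFilter Γ,
      R ^ finrank ℝ (kerOn f (F⁻¹ * K) (F⁻¹ : Finset Γ)) ≤ Real.exp (δ * F.card) := by
  filter_upwards [hf K (δ / (|Real.log R| + 1)) (by positivity)] with F hF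
  rw [div_mul_eq_mul_div, le_div_iff₀ (by positivity)] at hF
  rw [← Real.exp_log hR, ← Real.exp_nat_mul, Real.exp_le_exp]
  refine le_trans ?_ hF
  gcongr
  linarith [le_abs_self (Real.log R)]

open scoped Classical in
theorem eventually_card_thresholdSets_le (hf : HasSublinearKernels f) (K : Finset Γ) {δ : ℝ}
    (hδ : 0 < δ) : ∀ᶠ F in leftFolnerFilter Γ, ∀ t : (F⁻¹ * K : Finset Γ) → ℝ,
      ((thresholdSets (kerOn f (F⁻¹ * K) (F⁻¹ : Finset Γ)) t).card : ℝ) ≤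
        Real.exp (δ * F.card) := by
  obtain ⟨τ, hτ, hτ1, hτK⟩ : ∃ τ : ℝ, 0 < τ ∧ τ ≤ 1 ∧ τ * K.card ≤ δ / 2 := by
    refine ⟨min 1 (δ / 2 / (K.card + 1)), by positivity, min_le_left _ _, ?_⟩
    calc min 1 (δ / 2 / (K.card + 1)) * K.card ≤ δ / 2 / (K.card + 1) * (K.card + 1) := by
          gcongr
          · exact min_le_right _ _
          · linarith
      _ = δ / 2 := by field_simp
  filter_upwards [hf.eventually_pow_finrank_le K (inv_pos.2 hτ) (half_pos hδ)] with F hF t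
  set W := kerOn f (F⁻¹ * K) (F⁻¹ : Finset Γ)
  have hcard : τ * Fintype.card (F⁻¹ * K : Finset Γ) ≤ δ / 2 * F.card := by
    have h : (Fintype.card (F⁻¹ * K : Finset Γ) : ℝ) ≤ F.card * K.card := by
      rw [Fintype.card_coe, ← Finset.card_inv F]
      exact_mod_cast Finset.card_mul_le
    calc τ * Fintype.card (F⁻¹ * K : Finset Γ) ≤ τ * (F.card * K.card) := by gcongr
      _ = τ * K.card * F.card := by ring
      _ ≤ δ / 2 * F.card := by gcongr
  calc ((thresholdSets W t).card : ℝ)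
      = (thresholdSets W t).card * τ ^ finrank ℝ W * τ⁻¹ ^ finrank ℝ W := by
        rw [mul_assoc, ← mul_pow, mul_inv_cancel₀ hτ.ne', one_pow, mul_one]
    _ ≤ Real.exp (δ / 2 * F.card) * Real.exp (δ / 2 * F.card) := by
        gcongr
        exact (card_thresholdSets_mul_pow_le W t hτ.le hτ1).trans (Real.exp_le_exp.2 hcard)
    _ = Real.exp (δ * F.card) := by
        rw [← Real.exp_add]
        ring_nf

end HasSublinearKernels

end Kernels

/-! ### Comparison of the entropies -/

section Fibres

open Module

variable {Γ : Type*} [Group Γ] {f : MonoidAlgebra ℤ Γ} {A : Finset Γ} {E : Set Γ}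

theorem isCoveredBy_of_rightConv_eqOn (hA : ∀ γ ∈ E, ∀ δ ∈ f.coeff.support, γ * δ ∈ A)
    {ε : ℝ} (hε : 0 < ε) {C : Set (Set (YfBar f))}
    (hC : ∀ y : YfBar f, ∃ s ∈ C, ∀ y' : YfBar f,
      (∀ a ∈ A, dist (y.1.1 a) (y'.1.1 a) < ε) → y' ∈ s)
    {S : Set (YfBar f)} (hS : ∀ y ∈ S, ∀ y' ∈ S, ∀ γ ∈ E,
      rightConv f y.1.1 γ = rightConv f y'.1.1 γ) :
    IsCoveredBy C ((1 + 2 * 1 / (ε / 3)) ^ finrank ℝ (kerOn f A E)) S := by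
  rcases S.eq_empty_or_nonempty with rfl | ⟨y₀, hy₀⟩
  · exact isCoveredBy_empty (by positivity)
  have hker : ∀ y : S, (fun a : A => (y.1.1.1 - y₀.1.1) a) ∈ kerOn f A E := fun y =>
    restrict_mem_kerOn hA fun γ hγ => by
      rw [rightConv_sub, Pi.sub_apply, hS y y.2 y₀ hy₀ γ hγ, sub_self]
  let π : S → kerOn f A E := fun y => ⟨_, hker y⟩
  have hπ : ∀ y, π y ∈ Metric.closedBall 0 1 := fun y => by
    refine mem_closedBall_zero_iff.2 ((pi_norm_le_iff_of_nonneg zero_le_one).2 fun a => ?_)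
    have h := mem_Icc_of_mem_YfBar y.1.2 a
    have h₀ := mem_Icc_of_mem_YfBar y₀.2 a
    change |y.1.1.1 a - y₀.1.1 a| ≤ 1
    rw [abs_le]
    constructor <;> linarith [h.1, h.2, h₀.1, h₀.2]
  have hdist : ∀ y y' : S, ∀ a ∈ A, dist (y.1.1.1 a) (y'.1.1.1 a) ≤ dist (π y) (π y') := by
    intro y y' a ha
    rw [← dist_sub_right _ _ (y₀.1.1 a)]
    exact dist_le_pi_dist (π y).1 (π y').1 ⟨a, ha⟩
  obtain ⟨D, hDcard, hD⟩ := exists_finset_closedBall_subset_biUnion_closedBall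
    (E := kerOn f A E) zero_le_one (show 0 < ε / 3 by positivity)
  refine isCoveredBy_of_subset_biUnion (J := D)
    (T := fun d => (↑) '' (π ⁻¹' Metric.closedBall d (ε / 3))) hDcard (fun y hy => ?_) ?_
  · obtain ⟨d, hd, hyd⟩ := Set.mem_iUnion₂.1 (hD (hπ ⟨y, hy⟩))
    exact Set.mem_iUnion₂.2 ⟨d, hd, ⟨y, hy⟩, hyd, rfl⟩
  · rintro d - _ ⟨y, hyd, rfl⟩
    obtain ⟨s, hs, hys⟩ := hC y
    refine ⟨s, hs, ?_⟩
    rintro _ ⟨y', hyd', rfl⟩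
    refine hys _ fun a ha => (hdist y y' a ha).trans_lt ?_
    calc dist (π y) (π y') ≤ dist (π y) d + dist (π y') d := dist_triangle_right _ _ _
      _ ≤ ε / 3 + ε / 3 := add_le_add hyd hyd'
      _ < ε := by linarith

theorem topEntropy_YfBar_le_topEntropy_ZfBar (hf : HasSublinearKernels f) :
    topEntropy Γ (YfBar f) ≤ topEntropy Γ (ZfBar f) := by
  classical
  refine topEntropy_le_of_correspondence fun U hU =>
    ⟨smallCover (fun z : ZfBar f => z.1.1) {1} 1, isOpenCoverOf_smallCover
      (EllInf.continuous_val.comp continuous_subtype_val) {1} one_pos, fun δ hδ => ?_⟩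
  obtain ⟨K, ε, hε, hK⟩ := exists_mem_coverJoin_of_injective
    (EllInf.continuous_val.comp continuous_subtype_val)
    (Subtype.val_injective.comp Subtype.val_injective) (fun _ _ => rfl) hU
  filter_upwards [hf.eventually_pow_finrank_le (K ∪ f.coeff.support)
    (show 0 < 1 + 2 * 1 / (ε / 3) by positivity) hδ] with F hF
  let ρ : YfBar f → ZfBar f := fun y => ⟨rhoBar f y.1, rhoBar_mem_ZfBar y.2⟩
  refine ⟨fun y z => ρ y = z, fun y => ⟨ρ y, rfl⟩, fun v hv => ?_⟩
  refine (isCoveredBy_of_rightConv_eqOn (E := (F⁻¹ : Finset Γ))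
    (A := F⁻¹ * (K ∪ f.coeff.support)) ?_ hε ?_ ?_).mono hF
  · exact fun γ hγ δ hδ => Finset.mul_mem_mul hγ (Finset.mem_union_right _ hδ)
  · intro y
    obtain ⟨s, hs, hys⟩ := hK F y
    exact ⟨s, hs, fun y' hy' => hys y' fun γ hγ =>
      hy' γ (Finset.mul_subset_mul_left Finset.subset_union_left hγ)⟩
  · rintro y ⟨_, hy, rfl⟩ y' ⟨_, hy', rfl⟩ γ hγ
    exact eq_of_mem_ZfBar_of_dist_lt_one (ρ y).2 (ρ y').2
      (dist_lt_of_mem_coverJoin_smallCover (fun _ _ => rfl) hv hy hy'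
        (mul_one γ ▸ Finset.mul_mem_mul hγ (Finset.mem_singleton_self 1)))

end Fibres

section Carries

theorem round_sub_eq_ite {s t : ℝ} (hs : s ∈ Set.Ico (0 : ℝ) 1) (ht : t ∈ Set.Ico (0 : ℝ) 1) :
    round (t - s) = if 1 - s ≤ t - s - round (t - s) then -1
      else if -s ≤ t - s - round (t - s) then 0 else 1 := by
  have habs := abs_le.1 (abs_sub_round (t - s))
  have hlt : round (t - s) < 2 := by
    rw [← Int.cast_lt (R := ℝ)]
    push_cast
    linarith [hs.1, ht.2]
  have hgt : -2 < round (t - s) := by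
    rw [← Int.cast_lt (R := ℝ)]
    push_cast
    linarith [hs.2, ht.1]
  obtain ⟨ht0, ht1⟩ := ht
  generalize round (t - s) = m at hlt hgt ⊢
  interval_cases m
  · rw [if_pos (by push_cast; linarith)]
  · rw [if_neg (by push_cast; linarith), if_pos (by push_cast; linarith)]
  · rw [if_neg (by push_cast; linarith), if_neg (by push_cast; linarith)]

variable {Γ : Type*}

/-- The difference `y - y₀`, reduced modulo `1` to a function with values in `[-1/2, 1/2]`. -/
def reducedDiff (y₀ y : Γ → ℝ) : Γ → ℝ := fun γ => y γ - y₀ γ - round (y γ - y₀ γ)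

/-- The threshold sets of `reducedDiff y₀ y` on `A` for the thresholds `-y₀` and `1 - y₀`. When
`y₀` and `y` take values in `[0, 1)`, they record the integers carried when `reducedDiff y₀ y` is
added to `y₀`. -/
def carrySets (A : Finset Γ) (y₀ y : Γ → ℝ) : Finset A × Finset A :=
  (Finset.univ.filter fun a : A => -y₀ a ≤ reducedDiff y₀ y a,
    Finset.univ.filter fun a : A => 1 - y₀ a ≤ reducedDiff y₀ y a)

theorem carrySets_mem_product {A : Finset Γ} {W : Submodule ℝ (A → ℝ)} {y₀ y : Γ → ℝ}
    (h : (fun a : A => reducedDiff y₀ y a) ∈ W) : carrySets A y₀ y ∈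
      thresholdSets W (fun a => -y₀ a) ×ˢ thresholdSets W (fun a => 1 - y₀ a) :=
  Finset.mk_mem_product (filter_le_mem_thresholdSets _ h) (filter_le_mem_thresholdSets _ h)

theorem abs_reducedDiff_eq_dist (y₀ y : EllInf Γ) (γ : Γ) :
    |reducedDiff y₀.1 y.1 γ| = dist (etaMap y₀ γ) (etaMap y γ) := by
  rw [dist_comm, dist_eq_norm, etaMap, etaMap, ← AddCircle.coe_sub, UnitAddCircle.norm_eq,
    reducedDiff]

variable [Group Γ] {f : MonoidAlgebra ℤ Γ}

theorem round_sub_eq_of_carrySets_eq {y₀ y y' : EllInf Γ} (hy₀ : y₀ ∈ Yf f) (hy : y ∈ Yf f)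
    (hy' : y' ∈ Yf f) {A : Finset Γ} (h : carrySets A y₀.1 y.1 = carrySets A y₀.1 y'.1)
    {a : Γ} (ha : a ∈ A) : round (y.1 a - y₀.1 a) = round (y'.1 a - y₀.1 a) := by
  obtain ⟨h0, h1⟩ := Prod.ext_iff.1 h
  have h0a : -y₀.1 a ≤ reducedDiff y₀.1 y.1 a ↔ -y₀.1 a ≤ reducedDiff y₀.1 y'.1 a := by
    simpa [carrySets] using Finset.ext_iff.1 h0 ⟨a, ha⟩
  have h1a : 1 - y₀.1 a ≤ reducedDiff y₀.1 y.1 a ↔ 1 - y₀.1 a ≤ reducedDiff y₀.1 y'.1 a := by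
    simpa [carrySets] using Finset.ext_iff.1 h1 ⟨a, ha⟩
  rw [round_sub_eq_ite (hy₀.2 a) (hy.2 a), round_sub_eq_ite (hy₀.2 a) (hy'.2 a)]
  exact if_congr h1a rfl (if_congr h0a rfl rfl)

theorem rightConv_reducedDiff (y₀ y : Γ → ℝ) (γ : Γ) :
    rightConv f (reducedDiff y₀ y) γ = rightConv f y γ - rightConv f y₀ γ -
      (rightConv f (fun γ => round (y γ - y₀ γ)) γ : ℤ) := by
  rw [← rightConv_intCast]
  change rightConv f (y - y₀ - fun γ => (round (y γ - y₀ γ) : ℝ)) γ = _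
  rw [rightConv_sub, rightConv_sub]
  rfl

theorem rightConv_reducedDiff_eq_zero {y₀ y : EllInf Γ} (hy₀ : y₀ ∈ Yf f) (hy : y ∈ Yf f)
    {ε : ℝ} (hε : ellOneNorm f * ε < 1) {γ : Γ}
    (h : ∀ δ ∈ f.coeff.support, |reducedDiff y₀.1 y.1 (γ * δ)| ≤ ε) :
    rightConv f (reducedDiff y₀.1 y.1) γ = 0 := by
  have hlt := (abs_rightConv_le h).trans_lt hε
  obtain ⟨n₀, hn₀⟩ := coe_mem_Xf_iff.1 hy₀.1 γ
  obtain ⟨n, hn⟩ := coe_mem_Xf_iff.1 hy.1 γ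
  rw [rightConv_reducedDiff, ← hn₀, ← hn] at hlt ⊢
  norm_cast at hlt ⊢
  exact Int.abs_lt_one_iff.1 hlt

theorem rightConv_eq_of_carrySets_eq {y₀ y y' : EllInf Γ} (hy₀ : y₀ ∈ Yf f) (hy : y ∈ Yf f)
    (hy' : y' ∈ Yf f) {A : Finset Γ} (hcarry : carrySets A y₀.1 y.1 = carrySets A y₀.1 y'.1)
    {γ : Γ} (hA : ∀ δ ∈ f.coeff.support, γ * δ ∈ A)
    (h : rightConv f (reducedDiff y₀.1 y.1) γ = 0)
    (h' : rightConv f (reducedDiff y₀.1 y'.1) γ = 0) : rightConv f y.1 γ = rightConv f y'.1 γ := by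
  have hround : rightConv f (fun γ => round (y.1 γ - y₀.1 γ)) γ =
      rightConv f (fun γ => round (y'.1 γ - y₀.1 γ)) γ :=
    rightConv_congr fun δ hδ => round_sub_eq_of_carrySets_eq hy₀ hy hy' hcarry (hA δ hδ)
  rw [rightConv_reducedDiff, hround] at h
  rw [rightConv_reducedDiff] at h'
  linarith

theorem isCoveredBy_of_dist_etaMap_lt {E' E A : Finset Γ} (hE : E' ⊆ E)
    (hA : ∀ γ ∈ E, ∀ δ ∈ f.coeff.support, γ * δ ∈ A) {ε Q : ℝ} (hε : ellOneNorm f * ε < 1)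
    {C : Set (Set (ZfBar f))}
    (hC : ∀ z : ZfBar f, ∃ s ∈ C, ∀ z' : ZfBar f, (∀ γ ∈ E, z.1.1 γ = z'.1.1 γ) → z' ∈ s)
    (hQ : ∀ t : A → ℝ, ((thresholdSets (kerOn f A E') t).card : ℝ) ≤ Q)
    {P : Set (EllInf Γ)} (hP : P ⊆ Yf f)
    (hPdist : ∀ y ∈ P, ∀ y' ∈ P, ∀ a ∈ A, dist (etaMap y a) (etaMap y' a) < ε)
    {S : Set (ZfBar f)} (hS : ∀ z ∈ S, ∃ y ∈ P, ∀ γ ∈ E, rightConv f y.1 γ = z.1.1 γ) :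
    IsCoveredBy C (Q * Q) S := by
  have hQ0 : 0 ≤ Q := (Nat.cast_nonneg _).trans (hQ 0)
  rcases P.eq_empty_or_nonempty with rfl | ⟨y₀, hy₀⟩
  · rw [Set.eq_empty_of_forall_notMem fun z hz => (hS z hz).elim fun _ h => h.1]
    exact isCoveredBy_empty (mul_nonneg hQ0 hQ0)
  have hzero : ∀ y ∈ P, ∀ γ ∈ E, rightConv f (reducedDiff y₀.1 y.1) γ = 0 := fun y hy γ hγ =>
    rightConv_reducedDiff_eq_zero (hP hy₀) (hP hy) hε fun δ hδ =>
      (abs_reducedDiff_eq_dist y₀ y _).trans_le (hPdist y₀ hy₀ y hy _ (hA γ hγ δ hδ)).le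
  refine isCoveredBy_of_subset_biUnion
    (J := thresholdSets (kerOn f A E') (fun a => -y₀.1 a) ×ˢ
      thresholdSets (kerOn f A E') (fun a => 1 - y₀.1 a))
    (T := fun p => {z | ∃ y ∈ P, (∀ γ ∈ E, rightConv f y.1 γ = z.1.1 γ) ∧
      carrySets A y₀.1 y.1 = p}) ?_ (fun z hz => ?_) ?_
  · rw [Finset.card_product, Nat.cast_mul]
    exact mul_le_mul (hQ _) (hQ _) (Nat.cast_nonneg _) hQ0
  · obtain ⟨y, hy, hyz⟩ := hS z hz
    exact Set.mem_iUnion₂.2 ⟨_, carrySets_mem_product (restrict_mem_kerOn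
      (fun γ hγ => hA γ (hE hγ)) fun γ hγ => hzero y hy γ (hE hγ)), y, hy, hyz, rfl⟩
  · rintro p - z ⟨y, hy, hyz, hyp⟩
    obtain ⟨s, hs, hzs⟩ := hC z
    refine ⟨s, hs, fun z' ⟨y', hy', hyz', hyp'⟩ => hzs z' fun γ hγ => ?_⟩
    rw [← hyz γ hγ, ← hyz' γ hγ]
    exact rightConv_eq_of_carrySets_eq (hP hy₀) (hP hy) (hP hy') (hyp.trans hyp'.symm) (hA γ hγ)
      (hzero y hy γ hγ) (hzero y' hy' γ hγ)

theorem topEntropy_ZfBar_le_topEntropy_Xf (hf : HasSublinearKernels f) :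
    topEntropy Γ (ZfBar f) ≤ topEntropy Γ (Xf f) := by
  classical
  refine topEntropy_le_of_correspondence fun U hU => ?_
  obtain ⟨K₀, ε₀, hε₀, hK₀⟩ := exists_mem_coverJoin_of_injective
    (EllInf.continuous_val.comp continuous_subtype_val)
    (Subtype.val_injective.comp Subtype.val_injective) (fun _ _ => rfl) hU
  obtain ⟨ε, hε, hεf⟩ := exists_pos_mul_lt one_pos (ellOneNorm f)
  let K := insert 1 K₀
  let K' := K * f.coeff.support
  refine ⟨smallCover Subtype.val K' ε, isOpenCoverOf_smallCover continuous_subtype_val K' hε,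
    fun δ hδ => ?_⟩
  filter_upwards [hf.eventually_card_thresholdSets_le K' (half_pos hδ)] with F hF
  have hbase : F⁻¹ ⊆ F⁻¹ * K := Finset.subset_mul_left _ (Finset.mem_insert_self 1 K₀)
  have hwindow : ∀ γ ∈ F⁻¹ * K, ∀ δ ∈ f.coeff.support, γ * δ ∈ F⁻¹ * K' := fun γ hγ δ hδ => by
    rw [← mul_assoc]
    exact Finset.mul_mem_mul hγ hδ
  refine ⟨fun z x => ∃ y ∈ Yf f, x.1 = etaMap y ∧ ∀ γ ∈ F⁻¹ * K, rightConv f y.1 γ = z.1.1 γ,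
    fun z => ?_, fun v hv => ?_⟩
  · obtain ⟨y, hy, hyz⟩ := exists_mem_Yf_eqOn_of_mem_ZfBar z.2 (F⁻¹ * K)
    exact ⟨⟨etaMap y, hy.1⟩, y, hy, rfl, hyz⟩
  · refine (isCoveredBy_of_dist_etaMap_lt hbase hwindow hεf ?_ hF
      (P := {y | y ∈ Yf f ∧ ∃ x ∈ v, x.1 = etaMap y}) (fun y hy => hy.1) ?_ ?_).mono ?_
    · intro z
      obtain ⟨s, hs, hzs⟩ := hK₀ F z
      refine ⟨s, hs, fun z' hz' => hzs z' fun γ hγ => ?_⟩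
      have hγK : γ ∈ F⁻¹ * K := Finset.mul_subset_mul_left (Finset.subset_insert 1 K₀) hγ
      simpa [hz' γ hγK] using hε₀
    · rintro y ⟨-, x, hx, hxy⟩ y' ⟨-, x', hx', hxy'⟩ a ha
      rw [← hxy, ← hxy']
      exact dist_lt_of_mem_coverJoin_smallCover (fun _ _ => rfl) hv hx hx' ha
    · rintro z ⟨x, hx, y, hy, hxy, hyz⟩
      exact ⟨y, ⟨hy, x, hx, hxy⟩, hyz⟩
    · rw [← Real.exp_add, ← add_mul, add_halves]

end Carries

theorem theorem3p7_general {Γ : Type*} [Group Γ] (_hΓ : IsAmenableGroup Γ)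
    (f : MonoidAlgebra ℤ Γ) (hf : topEntropy Γ (Xf f) < ⊤) :
    topEntropy Γ (ZfBar f) = topEntropy Γ (YfBar f) ∧
      topEntropy Γ (YfBar f) = topEntropy Γ (Xf f) := by
  have hker := hasSublinearKernels_of_topEntropy_lt_top hf
  have hXY := topEntropy_Xf_le_topEntropy_YfBar f
  have hYZ := topEntropy_YfBar_le_topEntropy_ZfBar hker
  have hZX := topEntropy_ZfBar_le_topEntropy_Xf hker
  exact ⟨le_antisymm (hZX.trans hXY) hYZ, le_antisymm (hYZ.trans hZX) hXY⟩

end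

theorem theorem3p7 {Γ : Type*} [Group Γ] [Countable Γ] [Infinite Γ] (hΓ : IsAmenableGroup Γ)
    (f : MonoidAlgebra ℤ Γ) (hf : topEntropy Γ (Xf f) < ⊤) :
    topEntropy Γ (ZfBar f) = topEntropy Γ (YfBar f) ∧
      topEntropy Γ (YfBar f) = topEntropy Γ (Xf f) :=
  theorem3p7_general hΓ f hf
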